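/- **Proposition (Supermodular ordering of Markov processes).** A function $f\colon\mathbb R^d\to\mathbb R$ is *supermodular* if $f(x)+f(y)\le f(x\wedge y)+f(x\vee y)$ for all $x,y\in\mathbb R^d$, with componentwise minimum and maximum. For a *weight* $b\colon\mathbb R^d\to[1,\infty)$ (measurable) and random vectors $V,W$ in $\mathbb R^d$, write $V\le_{sm}W$ if $\mathbb E\,b(V)<\infty$, $\mathbb E\,b(W)<\infty$ and $\mathbb E f(V)\le\mathbb E f(W)$ for all measurable supermodular $f$ with $\sup_x|f(x)|/b(x)<\infty$. Fix a weight $b_d$ on $\mathbb R^d$ for every $d$. For real-valued processes, $(V_i)_{i\in\mathbb N_0}\le_{sm}(W_i)_{i\in\mathbb N_0}$ means $(V_{n_1},\dots,V_{n_m})\le_{sm}(W_{n_1},\dots,W_{n_m})$ (with weight $b_m$) for all $m$ and all $n_1,\dots,n_m\in\mathbb N_0$. A process $V$ is *positive supermodular dependent* (PSMD) if $V^\perp\le_{sm}V$, where $V^\perp$ has independent components and $V^\perp_i\overset{d}{=}V_i$ for all $i$. For real random variables, $V\uparrow_{st}U$ means that, for $u$ outside a null set of the law of $U$, the conditional law of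 $V$ given $U=u$ is increasing in $u$ with respect to the usual stochastic order. Let $X=(X_i)_{i\in\mathbb N_0}$ and $Y=(Y_i)_{i\in\mathbb N_0}$ be real-valued discrete-time Markov processes. Assume that the weights are integrable in terms of the marginals: for $Z\in\{X,Y\}$, all $m$ and all $n_1,\dots,n_m\in\mathbb N_0$ there are $c\in\mathbb R$ and functions $\beta_1,\dots,\beta_m\colon\mathbb R\to\mathbb R$ with $\mathbb E|\beta_k(Z_{n_k})|<\infty$ and $b_m(x)\le c+\sum_{k=1}^m\beta_k(x_k)$ for all $x\in\mathbb R^m$ (this is automatic for bounded weights, and holds for $b_m(x)=\max\{1,\|x\|^p\}$ if all $X_i,Y_i$ have finite $p$-th absolute moments). Assume for all $i\in\mathbb N_0$ that 1. $X_{i+1}\uparrow_{st}X_i$, 2. $Y_i\uparrow_{st}Y_{i+1}$, 3. $(X_i,X_{i+1})\le_{sm}(Y_i,Y_{i+1})$ (resp. $(X_i,X_{i+1})\ge_{sm}(Y_i,Y_{i+1})$). Then $X\le_{sm}Y$ (resp. $X\ge_{sm}Y$). Moreover, in both cases $X$ and $Y$ are PSMD. -/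

import Mathlib

open MeasureTheory ProbabilityTheory

/-- `f (x) + f (y) ≤ f (x ∧ y) + f (x ∨ y)` with componentwise minimum and maximum. -/
def Supermodular {d : ℕ} (f : (Fin d → ℝ) → ℝ) : Prop :=
  ∀ x y : Fin d → ℝ, f x + f y ≤ f (x ⊓ y) + f (x ⊔ y)

/-- A weight function on `ℝ^d`: measurable with values in `[1, ∞)`. -/
def IsWeight {d : ℕ} (b : (Fin d → ℝ) → ℝ) : Prop :=
  Measurable b ∧ ∀ x, 1 ≤ b x

/-- Supermodular order of two laws on `ℝ^d` with respect to the weight `b`: both laws integrate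
`b`, and the integrals of all measurable `b`-bounded supermodular functions are ordered. -/
def SupermodularLE {d : ℕ} (b : (Fin d → ℝ) → ℝ) (μ ν : Measure (Fin d → ℝ)) : Prop :=
  Integrable b μ ∧ Integrable b ν ∧
    ∀ f : (Fin d → ℝ) → ℝ, Measurable f → Supermodular f →
      (∃ C : ℝ, ∀ x, |f x| ≤ C * b x) → ∫ x, f x ∂μ ≤ ∫ x, f x ∂ν

/-- Supermodular order of the laws of two real sequences, through all finite-dimensional
marginals; `b d` is the weight function used in dimension `d`. -/
def ProcessSupermodularLE (b : (d : ℕ) → (Fin d → ℝ) → ℝ) (μ ν : Measure (ℕ → ℝ)) : Prop :=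
  ∀ (m : ℕ) (n : Fin m → ℕ),
    SupermodularLE (b m) (μ.map fun x k => x (n k)) (ν.map fun x k => x (n k))

/-- The law of a sequence of random variables. -/
noncomputable def processLaw {Ω : Type*} [MeasurableSpace Ω] (P : Measure Ω) (X : ℕ → Ω → ℝ) :
    Measure (ℕ → ℝ) :=
  P.map fun ω i => X i ω

/-- The law of `(X i, X (i + 1))`. -/
noncomputable def consecutiveLaw {Ω : Type*} [MeasurableSpace Ω] (P : Measure Ω)
    (X : ℕ → Ω → ℝ) (i : ℕ) : Measure (Fin 2 → ℝ) :=
  P.map fun ω => ![X i ω, X (i + 1) ω]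

/-- The law of an independent sequence with the same one-dimensional marginals as `X`. -/
noncomputable def independentLaw {Ω : Type*} [MeasurableSpace Ω] (P : Measure Ω)
    (X : ℕ → Ω → ℝ) : Measure (ℕ → ℝ) :=
  Measure.infinitePi fun i => P.map (X i)

/-- Positive supermodular dependence: the process exceeds, in the supermodular order, the
independent process with the same marginals. -/
def IsPSMD {Ω : Type*} [MeasurableSpace Ω] (b : (d : ℕ) → (Fin d → ℝ) → ℝ) (P : Measure Ω)
    (X : ℕ → Ω → ℝ) : Prop :=
  ProcessSupermodularLE b (independentLaw P X) (processLaw P X)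

/-- The usual stochastic order `μ ≤_st ν` of laws on `ℝ`. -/
def StochasticLE (μ ν : Measure ℝ) : Prop :=
  ∀ f : ℝ → ℝ, Monotone f → Integrable f μ → Integrable f ν → ∫ v, f v ∂μ ≤ ∫ v, f v ∂ν

/-- `V ↑_st U`: outside a null set of the law of `U`, the conditional law of `V` given `U = u` is
increasing in `u` with respect to the stochastic order. -/
def StochasticallyIncreasing {Ω : Type*} [MeasurableSpace Ω] (P : Measure Ω) [IsFiniteMeasure P]
    (V U : Ω → ℝ) : Prop :=
  ∃ S : Set ℝ, (∀ᵐ u ∂(P.map U), u ∈ S) ∧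
    ∀ u ∈ S, ∀ u' ∈ S, u ≤ u' → StochasticLE (condDistrib V U P u) (condDistrib V U P u')

/-- Markov process in discrete time: measurable, and the conditional probabilities of the next
state given the whole past and given the present state agree almost surely. -/
def IsMarkovProcess {Ω : Type*} [MeasurableSpace Ω] (P : Measure Ω) (X : ℕ → Ω → ℝ) : Prop :=
  (∀ i, Measurable (X i)) ∧
    ∀ (n : ℕ) (B : Set ℝ), MeasurableSet B →
      P⟦X (n + 1) ⁻¹' B | ⨆ j ≤ n, MeasurableSpace.comap (X j) inferInstance⟧ =ᵐ[P]
        P⟦X (n + 1) ⁻¹' B | MeasurableSpace.comap (X n) inferInstance⟧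

/-- The weights are integrable along `X` in terms of the one-dimensional marginals: the weight on
each finite-dimensional marginal of `X` is bounded by a sum of integrable functions of the single
components. It covers bounded weights for every `X`, and `max 1 (‖x‖ ^ p)` whenever every `X i` has
a finite absolute moment of order `p`. It puts every finite-dimensional marginal of `X`, and its
independent version, into the class of `b`-integrable vectors. -/
def MarginallyIntegrable {Ω : Type*} [MeasurableSpace Ω] (b : (d : ℕ) → (Fin d → ℝ) → ℝ)
    (P : Measure Ω) (X : ℕ → Ω → ℝ) : Prop :=
  ∀ (m : ℕ) (n : Fin m → ℕ), ∃ (c : ℝ) (β : Fin m → ℝ → ℝ),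
    (∀ k, Integrable (β k) (P.map (X (n k)))) ∧ ∀ x, b m x ≤ c + ∑ k, β k (x k)

/-! For bounded test functions the coordinates are decoupled one at a time, each first coordinate
being resampled from the backward transition of `Y` given its successor. Integrating out the later
coordinates by the forward transitions of `X` reduces such a replacement to the hypothesis on
consecutive pairs, and stochastic monotonicity of the transitions keeps the test function
supermodular throughout. Since the order equates the one-dimensional marginals, truncation passes
from bounded test functions to those dominated by the weight.

An independent sequence is a Markov process that is stochastically increasing in both directions,
and symmetrization shows that its consecutive pairs are dominated by those of `X` and of `Y`.
Positive supermodular dependence is therefore the comparison of each process with its independent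
version. -/

open Set Filter Topology

section Supermodular

/-- Supermodularity on an arbitrary lattice. It extends `Supermodular` from `Fin d → ℝ` to
sequence space and to the plane. -/
def IsSupermodular {α : Type*} [Lattice α] (f : α → ℝ) : Prop :=
  ∀ x y, f x + f y ≤ f (x ⊓ y) + f (x ⊔ y)

variable {ι κ : Type*}

lemma IsSupermodular.comp_reindex {f : (κ → ℝ) → ℝ} (hf : IsSupermodular f) (σ : κ → ι)
    {g : κ → ℝ → ℝ} (hg : ∀ k, Monotone (g k)) :
    IsSupermodular fun x : ι → ℝ => f fun k => g k (x (σ k)) := by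
  intro x y
  have hinf : (fun k => g k ((x ⊓ y) (σ k))) =
      (fun k => g k (x (σ k))) ⊓ fun k => g k (y (σ k)) := funext fun k => (hg k).map_inf _ _
  have hsup : (fun k => g k ((x ⊔ y) (σ k))) =
      (fun k => g k (x (σ k))) ⊔ fun k => g k (y (σ k)) := funext fun k => (hg k).map_sup _ _
  simpa only [hinf, hsup] using hf _ _

variable [DecidableEq ι]

lemma update_inf_update {α : Type*} [Lattice α] (x y : ι → α) (j : ι) (s t : α) :
    Function.update x j s ⊓ Function.update y j t = Function.update (x ⊓ y) j (s ⊓ t) :=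
  funext fun k => Function.apply_update₂ (fun _ => (· ⊓ ·)) x y j s t k

lemma update_sup_update {α : Type*} [Lattice α] (x y : ι → α) (j : ι) (s t : α) :
    Function.update x j s ⊔ Function.update y j t = Function.update (x ⊔ y) j (s ⊔ t) :=
  funext fun k => Function.apply_update₂ (fun _ => (· ⊔ ·)) x y j s t k

lemma IsSupermodular.comp_update {f : (ι → ℝ) → ℝ} (hf : IsSupermodular f) (j : ι) (s : ℝ) :
    IsSupermodular fun x => f (Function.update x j s) := by
  intro x y
  simpa only [update_inf_update, update_sup_update, inf_idem, sup_idem] using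
    hf (Function.update x j s) (Function.update y j s)

lemma IsSupermodular.monotone_sub {f : (ι → ℝ) → ℝ} (hf : IsSupermodular f) {x y : ι → ℝ}
    (hxy : x ≤ y) (j : ι) :
    Monotone fun s => f (Function.update y j s) - f (Function.update x j s) := by
  intro s t hst
  have h := hf (Function.update y j s) (Function.update x j t)
  rw [update_inf_update, update_sup_update, inf_eq_right.2 hxy, sup_eq_left.2 hxy,
    inf_eq_left.2 hst, sup_eq_right.2 hst] at h
  change f _ - f _ ≤ f _ - f _
  linarith

/-- Move the coordinates one at a time: the increment along an axis grows with the base point. -/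
lemma IsSupermodular.sum_sub_le [Fintype ι] {f : (ι → ℝ) → ℝ} (hf : IsSupermodular f)
    {a x y : ι → ℝ} (hax : a ≤ x) (hxy : x ≤ y) :
    ∑ k, (f (Function.update a k (y k)) - f (Function.update a k (x k))) ≤ f y - f x := by
  have partial_sum_le (s : Finset ι) :
      ∑ k ∈ s, (f (Function.update a k (y k)) - f (Function.update a k (x k))) ≤
        f (s.piecewise y x) - f x := by
    induction s using Finset.induction_on with
    | empty => simp
    | insert k s hk ih =>
      have hle : a ≤ s.piecewise y x := s.le_piecewise_of_le_of_le (hax.trans hxy) hax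
      have h := hf.monotone_sub hle k (hxy k)
      have hself : Function.update (s.piecewise y x) k (x k) = s.piecewise y x :=
        Function.update_eq_self_iff.2 (s.piecewise_eq_of_notMem y x hk).symm
      rw [Finset.sum_insert hk, Finset.piecewise_insert]
      simp only [hself] at h
      linarith
  simpa using partial_sum_le Finset.univ

end Supermodular

section StochasticOrder

variable {p q : Measure ℝ}

lemma isLowerSet_eq_Iic_or_iUnion_Iic {L : Set ℝ} (hL : IsLowerSet L) :
    (∃ a, L = Iic a) ∨ L = ⋃ r : {r : ℚ // (r : ℝ) ∈ L}, Iic ((r : ℚ) : ℝ) := by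
  by_cases hmax : ∃ a, IsGreatest L a
  · obtain ⟨a, ha, hub⟩ := hmax
    exact Or.inl ⟨a, Subset.antisymm (fun x hx => hub hx) fun x hx => hL hx ha⟩
  · refine Or.inr (Subset.antisymm (fun x hx => ?_) (iUnion_subset fun r _ hy => hL hy r.2))
    obtain ⟨y, hy, hxy⟩ : ∃ y ∈ L, x < y := by
      by_contra! hcon
      exact hmax ⟨x, hx, hcon⟩
    obtain ⟨r, hxr, hry⟩ := exists_rat_btwn hxy
    exact mem_iUnion.2 ⟨⟨r, hL hry.le hy⟩, hxr.le⟩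

lemma measure_le_of_isLowerSet (h : ∀ t, q (Iic t) ≤ p (Iic t)) {L : Set ℝ}
    (hL : IsLowerSet L) : q L ≤ p L := by
  rcases isLowerSet_eq_Iic_or_iUnion_Iic hL with ⟨a, rfl⟩ | hU
  · exact h a
  · have hd : Directed (· ⊆ ·) fun r : {r : ℚ // (r : ℝ) ∈ L} => Iic ((r : ℚ) : ℝ) :=
      directed_of_isDirected_le fun r s hrs => Iic_subset_Iic.2 (by exact_mod_cast hrs)
    rw [hU, hd.measure_iUnion, hd.measure_iUnion]
    exact iSup_mono fun r => h _

lemma measure_le_of_isUpperSet [IsProbabilityMeasure p] [IsProbabilityMeasure q]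
    (h : ∀ t, q (Iic t) ≤ p (Iic t)) {U : Set ℝ} (hU : IsUpperSet U) (hUm : MeasurableSet U) :
    p U ≤ q U := by
  rw [← compl_compl U, prob_compl_eq_one_sub hUm.compl, prob_compl_eq_one_sub hUm.compl]
  exact tsub_le_tsub_left (measure_le_of_isLowerSet h hU.compl) 1

lemma lintegral_ofReal_le_of_measure_superlevel_le {α : Type*} [MeasurableSpace α]
    {μ ν : Measure α} {g : α → ℝ} (hg : Measurable g) (h : ∀ t, μ {a | t < g a} ≤ ν {a | t < g a}) :
    ∫⁻ a, ENNReal.ofReal (g a) ∂μ ≤ ∫⁻ a, ENNReal.ofReal (g a) ∂ν := by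
  have hpos (a : α) : ENNReal.ofReal (g a) = ENNReal.ofReal (max (g a) 0) := by simp
  have layer_cake (ρ : Measure α) :
      ∫⁻ a, ENNReal.ofReal (g a) ∂ρ = ∫⁻ t in Ioi (0 : ℝ), ρ {a | t < g a} := by
    simp only [hpos]
    rw [lintegral_eq_lintegral_meas_lt ρ (ae_of_all _ fun a => le_max_right (g a) 0)
      (hg.max measurable_const).aemeasurable]
    refine setLIntegral_congr_fun measurableSet_Ioi fun t ht => ?_
    simp only [lt_max_iff, not_lt_of_gt (mem_Ioi.1 ht), or_false]
  rw [layer_cake, layer_cake]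
  exact lintegral_mono fun t => h t

lemma stochasticLE_iff_measure_Iic_le [IsProbabilityMeasure p] [IsProbabilityMeasure q] :
    StochasticLE p q ↔ ∀ t, q (Iic t) ≤ p (Iic t) := by
  refine ⟨fun h t => ?_, fun h f hf hfp hfq => ?_⟩
  · have hanti : Antitone ((Iic t).indicator fun _ => (1 : ℝ)) := fun a b hab => by
      refine indicator_apply_le' (fun hb => ?_) fun _ => indicator_nonneg (by simp) _
      rw [indicator_of_mem (mem_Iic.2 (hab.trans hb))]
    have hint (ρ : Measure ℝ) [IsProbabilityMeasure ρ] :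
        Integrable ((Iic t).indicator fun _ => (1 : ℝ)) ρ :=
      (integrable_const 1).indicator measurableSet_Iic
    have := h _ hanti.neg (hint p).neg (hint q).neg
    simpa [integral_neg, integral_indicator_const, measurableSet_Iic, measureReal_def,
      ENNReal.toReal_le_toReal] using this
  · have hpos : ∫⁻ z, ENNReal.ofReal (f z) ∂p ≤ ∫⁻ z, ENNReal.ofReal (f z) ∂q :=
      lintegral_ofReal_le_of_measure_superlevel_le hf.measurable fun t =>
        measure_le_of_isUpperSet h (fun _ _ hab ha => lt_of_lt_of_le ha (hf hab))
          (measurableSet_lt measurable_const hf.measurable)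
    have hneg : ∫⁻ z, ENNReal.ofReal (-f z) ∂q ≤ ∫⁻ z, ENNReal.ofReal (-f z) ∂p :=
      lintegral_ofReal_le_of_measure_superlevel_le hf.measurable.neg fun t =>
        measure_le_of_isLowerSet h fun _ _ hba ha => lt_of_lt_of_le ha (neg_le_neg (hf hba))
    rw [integral_eq_lintegral_pos_part_sub_lintegral_neg_part hfp,
      integral_eq_lintegral_pos_part_sub_lintegral_neg_part hfq]
    exact sub_le_sub (ENNReal.toReal_mono hfq.lintegral_lt_top.ne hpos)
      (ENNReal.toReal_mono hfp.neg.lintegral_lt_top.ne hneg)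

lemma StochasticLE.map (h : StochasticLE p q) {g : ℝ → ℝ} (hg : Monotone g) :
    StochasticLE (p.map g) (q.map g) := by
  intro f hf hfp hfq
  have hgm (ρ : Measure ℝ) : AEMeasurable g ρ := hg.measurable.aemeasurable
  have hfm (ρ : Measure ℝ) : AEStronglyMeasurable f ρ := hf.measurable.aestronglyMeasurable
  rw [integral_map (hgm p) (hfm _), integral_map (hgm q) (hfm _)]
  exact h _ (hf.comp hg) ((integrable_map_measure (hfm _) (hgm p)).1 hfp)
    ((integrable_map_measure (hfm _) (hgm q)).1 hfq)

end StochasticOrder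

/-- The laws `κ u` with `u ∈ S` increase with `u` in the usual stochastic order. -/
def StochasticallyMonotoneOn (κ : ℝ → Measure ℝ) (S : Set ℝ) : Prop :=
  ∀ u ∈ S, ∀ v ∈ S, u ≤ v → StochasticLE (κ u) (κ v)

section MonotoneExtension

variable {A B : Set (Measure ℝ)} {m : Measure ℝ} {a b t : ℝ}

lemma bddBelow_range_cdf (A : Set (Measure ℝ)) (t : ℝ) :
    BddBelow (range fun m : A => cdf m.1 t) :=
  ⟨0, by rintro _ ⟨m, rfl⟩; exact cdf_nonneg _ _⟩

/-- The pointwise infimum of the distribution functions of the laws in `A`. For nonempty `A` of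
laws on a common compact interval it is the distribution function of the supremum of `A` in the
stochastic order. -/
noncomputable def infCDF (A : Set (Measure ℝ)) : StieltjesFunction ℝ where
  toFun t := ⨅ m : A, cdf m.1 t
  mono' s t hst := ciInf_mono (bddBelow_range_cdf A s) fun m => monotone_cdf _ hst
  right_continuous' t := by
    rcases isEmpty_or_nonempty A with hA | hA
    · simp only [Real.iInf_of_isEmpty]
      exact continuousWithinAt_const
    refine tendsto_order.2 ⟨fun c hc => ?_, fun c hc => ?_⟩
    · filter_upwards [self_mem_nhdsWithin] with s hs
      exact hc.trans_le (ciInf_mono (bddBelow_range_cdf A t) fun m => monotone_cdf _ hs)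
    · obtain ⟨m, hm⟩ := exists_lt_of_ciInf_lt hc
      filter_upwards [((cdf m.1).right_continuous t).eventually_lt_const hm] with s hs
      exact (ciInf_le (bddBelow_range_cdf A s) m).trans_lt hs

lemma infCDF_le (hm : m ∈ A) (t : ℝ) : infCDF A t ≤ cdf m t :=
  ciInf_le (bddBelow_range_cdf A t) ⟨m, hm⟩

lemma le_infCDF (hA : A.Nonempty) {c : ℝ} (h : ∀ m ∈ A, c ≤ cdf m t) : c ≤ infCDF A t :=
  have := hA.to_subtype
  le_ciInf fun m => h m m.2

lemma infCDF_le_infCDF (hA : A.Nonempty) (hAB : A ⊆ B) (t : ℝ) : infCDF B t ≤ infCDF A t :=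
  le_infCDF hA fun _ hm => infCDF_le (hAB hm) t

lemma tendsto_infCDF_atBot (hA : A.Nonempty) : Tendsto (infCDF A) atBot (𝓝 0) := by
  obtain ⟨m, hm⟩ := hA
  exact squeeze_zero (fun t => le_infCDF ⟨m, hm⟩ fun _ _ => cdf_nonneg _ _)
    (infCDF_le hm) (tendsto_cdf_atBot m)

lemma tendsto_infCDF_atTop (hA : A.Nonempty) (hb : ∀ m ∈ A, cdf m b = 1) :
    Tendsto (infCDF A) atTop (𝓝 1) := by
  refine tendsto_const_nhds.congr' ?_
  filter_upwards [eventually_ge_atTop b] with t ht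
  obtain ⟨m, hm⟩ := hA
  refine le_antisymm (le_infCDF ⟨m, hm⟩ fun m hm => ?_) ((infCDF_le hm t).trans (cdf_le_one m t))
  exact (hb m hm).ge.trans (monotone_cdf m ht)

lemma cdf_eq_one_of_ae_le [IsProbabilityMeasure m] (h : ∀ᵐ z ∂m, z ≤ t) : cdf m t = 1 := by
  rw [cdf_eq_real, measureReal_def, (prob_compl_eq_zero_iff measurableSet_Iic).1 (ae_iff.1 h),
    ENNReal.toReal_one]

lemma cdf_eq_zero_of_ae_lt [IsProbabilityMeasure m] (h : ∀ᵐ z ∂m, t < z) : cdf m t = 0 := by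
  rw [cdf_eq_real, measureReal_eq_zero_iff]
  exact measure_mono_null (fun z (hz : z ≤ t) => not_lt.2 hz) (ae_iff.1 h)

lemma stochasticLE_iff_cdf_le {p q : Measure ℝ} [IsProbabilityMeasure p]
    [IsProbabilityMeasure q] : StochasticLE p q ↔ ∀ t, cdf q t ≤ cdf p t := by
  simp only [stochasticLE_iff_measure_Iic_le, ← ofReal_cdf,
    ENNReal.ofReal_le_ofReal_iff (cdf_nonneg _ _)]

/-- The laws `p s` with `s ∈ S` and `s ≤ u`, together with a law below all those on `[a, ∞)`. -/
def lowerLaws (p : ℝ → Measure ℝ) (S : Set ℝ) (a u : ℝ) : Set (Measure ℝ) :=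
  insert (Measure.dirac a) (p '' (S ∩ Iic u))

lemma lowerLaws_nonempty (p : ℝ → Measure ℝ) (S : Set ℝ) (a u : ℝ) :
    (lowerLaws p S a u).Nonempty := insert_nonempty _ _

lemma antitone_infCDF_lowerLaws (p : ℝ → Measure ℝ) (S : Set ℝ) (a t : ℝ) :
    Antitone fun u => infCDF (lowerLaws p S a u) t := fun _ _ huv =>
  infCDF_le_infCDF (lowerLaws_nonempty _ _ _ _)
    (insert_subset_insert (image_mono (inter_subset_inter_right S (Iic_subset_Iic.2 huv)))) t

variable {p : ℝ → Measure ℝ} {S : Set ℝ}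

lemma cdf_eq_one_of_mem_lowerLaws (hp : ∀ s ∈ S, IsProbabilityMeasure (p s))
    (hsupp : ∀ s ∈ S, ∀ᵐ z ∂p s, z ∈ Icc a b) {u : ℝ} :
    ∀ m ∈ lowerLaws p S a u, cdf m (max a b) = 1 := by
  rintro _ (rfl | ⟨s, ⟨hs, -⟩, rfl⟩)
  · exact cdf_eq_one_of_ae_le (by simp [ae_dirac_eq])
  · have := hp s hs
    exact cdf_eq_one_of_ae_le ((hsupp s hs).mono fun z hz => hz.2.trans (le_max_right a b))

lemma infCDF_lowerLaws_eq_cdf (hp : ∀ s ∈ S, IsProbabilityMeasure (p s))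
    (hsupp : ∀ s ∈ S, ∀ᵐ z ∂p s, z ∈ Icc a b) (hmono : StochasticallyMonotoneOn p S)
    {s : ℝ} (hs : s ∈ S) : infCDF (lowerLaws p S a s) = cdf (p s) := by
  have := hp s hs
  ext t
  refine le_antisymm (infCDF_le (Or.inr ⟨s, ⟨hs, self_mem_Iic⟩, rfl⟩) t)
    (le_infCDF (lowerLaws_nonempty _ _ _ _) ?_)
  rintro _ (rfl | ⟨r, ⟨hr, hrs⟩, rfl⟩)
  · rcases lt_or_ge t a with hta | hat
    · rw [cdf_eq_zero_of_ae_lt ((hsupp s hs).mono fun z hz => hta.trans_le hz.1)]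
      exact cdf_nonneg _ _
    · rw [cdf_eq_one_of_ae_le (m := Measure.dirac a) (by simpa [ae_dirac_eq] using hat)]
      exact cdf_le_one _ _
  · have := hp r hr
    exact stochasticLE_iff_cdf_le.1 (hmono r hr s hs hrs) t

/-- Outside `S` the supremum of the laws at lower states is used. Compactness of the supports
prevents mass from escaping to infinity in this supremum. -/
theorem StochasticallyMonotoneOn.exists_kernel (hp : ∀ s ∈ S, IsProbabilityMeasure (p s))
    (hsupp : ∀ s ∈ S, ∀ᵐ z ∂p s, z ∈ Icc a b) (hmono : StochasticallyMonotoneOn p S) :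
    ∃ κ : Kernel ℝ ℝ, IsMarkovKernel κ ∧ StochasticallyMonotoneOn κ univ ∧ ∀ s ∈ S, κ s = p s := by
  let G (u : ℝ) : StieltjesFunction ℝ := infCDF (lowerLaws p S a u)
  have hbot (u : ℝ) : Tendsto (G u) atBot (𝓝 0) := tendsto_infCDF_atBot (lowerLaws_nonempty _ _ _ _)
  have htop (u : ℝ) : Tendsto (G u) atTop (𝓝 1) :=
    tendsto_infCDF_atTop (lowerLaws_nonempty _ _ _ _) (cdf_eq_one_of_mem_lowerLaws hp hsupp)
  have hprob (u : ℝ) : IsProbabilityMeasure (G u).measure :=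
    StieltjesFunction.isProbabilityMeasure _ (hbot u) (htop u)
  have hcdf (u : ℝ) : cdf (G u).measure = G u :=
    cdf_measure_stieltjesFunction _ (hbot u) (htop u)
  have hanti (t : ℝ) : Antitone fun u => G u t := antitone_infCDF_lowerLaws p S a t
  have hmeas : Measurable fun u => (G u).measure := by
    refine .measure_of_isPiSystem_of_isProbabilityMeasure (borel_eq_generateFrom_Iic ℝ)
      isPiSystem_Iic ?_
    rintro _ ⟨t, rfl⟩
    simp only [← ofReal_cdf, hcdf]
    exact (hanti t).measurable.ennreal_ofReal
  refine ⟨⟨fun u => (G u).measure, hmeas⟩, ⟨hprob⟩, fun u _ v _ huv => ?_, fun s hs => ?_⟩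
  · refine stochasticLE_iff_cdf_le.2 fun t => ?_
    simpa only [Kernel.coe_mk, hcdf] using hanti t huv
  · have := hp s hs
    refine Measure.eq_of_cdf _ _ ((hcdf s).trans ?_)
    exact infCDF_lowerLaws_eq_cdf hp hsupp hmono hs

end MonotoneExtension

/-- Bounded measurable functions of the coordinates in `A`. -/
structure IsCylinder {ι : Type*} (F : (ι → ℝ) → ℝ) (A : Set ι) : Prop where
  measurable : Measurable F
  bounded : ∃ C, ∀ x, |F x| ≤ C
  dependsOn : DependsOn F A

/-- Integrates out the coordinate `j` with respect to the kernel `κ` at the coordinate `i`. -/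
noncomputable def resample {ι : Type*} [DecidableEq ι] (κ : Kernel ℝ ℝ) (i j : ι)
    (F : (ι → ℝ) → ℝ) (x : ι → ℝ) : ℝ :=
  ∫ z, F (Function.update x j z) ∂κ (x i)

/-- Under `μ` and within the coordinates `A`, the conditional law of the coordinate `j` given the
other ones is `κ` at the coordinate `i`. -/
def Disintegrates {ι : Type*} [DecidableEq ι] (μ : Measure (ι → ℝ)) (κ : Kernel ℝ ℝ) (i j : ι)
    (A : Set ι) : Prop :=
  ∀ F, IsCylinder F A → ∫ x, F x ∂μ = ∫ x, resample κ i j F x ∂μ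

section Resampling

variable {ι : Type*} {F : (ι → ℝ) → ℝ} {A B : Set ι}

namespace IsCylinder

lemma mono (hF : IsCylinder F A) (h : A ⊆ B) : IsCylinder F B :=
  ⟨hF.measurable, hF.bounded, hF.dependsOn.mono h⟩

lemma comp_pi (hF : IsCylinder F A) {g : ι → ℝ → ℝ} (hg : ∀ i, Measurable (g i)) :
    IsCylinder (fun x => F fun i => g i (x i)) A := by
  obtain ⟨C, hC⟩ := hF.bounded
  exact ⟨hF.measurable.comp (measurable_pi_iff.2 fun i => (hg i).comp (measurable_pi_apply i)),
    ⟨C, fun x => hC _⟩, fun x y h => hF.dependsOn fun i hi => congrArg (g i) (h i hi)⟩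

variable [DecidableEq ι]

lemma integrable_update (hF : IsCylinder F A) (x : ι → ℝ) (j : ι) (p : Measure ℝ)
    [IsFiniteMeasure p] : Integrable (fun z => F (Function.update x j z)) p := by
  obtain ⟨C, hC⟩ := hF.bounded
  exact Integrable.of_bound (hF.measurable.comp (measurable_update x)).aestronglyMeasurable C
    (ae_of_all _ fun z => hC _)

variable (κ η : Kernel ℝ ℝ) [IsMarkovKernel κ] [IsMarkovKernel η]

protected lemma resample (hF : IsCylinder F A) {i j : ι} (hA : A \ {j} ⊆ B) (hi : i ∈ B) :
    IsCylinder (resample κ i j F) B := by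
  obtain ⟨C, hC⟩ := hF.bounded
  refine ⟨?_, ⟨C, fun x => ?_⟩, fun x y h => ?_⟩
  · have hm : StronglyMeasurable fun p : (ι → ℝ) × ℝ => F (Function.update p.1 j p.2) :=
      (hF.measurable.comp measurable_update').stronglyMeasurable
    exact (hm.integral_kernel_prod_right'
      (κ := κ.comap (fun x : ι → ℝ => x i) (measurable_pi_apply i))).measurable
  · simpa [resample] using
      norm_integral_le_of_norm_le_const (μ := κ (x i))
        (ae_of_all _ fun z => (Real.norm_eq_abs _).trans_le (hC (Function.update x j z)))
  · have hupd (z : ℝ) : F (Function.update x j z) = F (Function.update y j z) := by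
      refine hF.dependsOn fun k hk => ?_
      rcases eq_or_ne k j with rfl | hkj
      · simp
      · simpa only [Function.update_of_ne hkj] using h k (hA ⟨hk, hkj⟩)
    simp only [resample, h i hi, hupd]

lemma resample_comm (hF : IsCylinder F A) {i j k l : ι} (hjl : j ≠ l) (hil : i ≠ l)
    (hkj : k ≠ j) :
    resample κ i j (resample η k l F) = resample η k l (resample κ i j F) := by
  ext x
  simp only [resample, Function.update_of_ne hkj, Function.update_of_ne hil]
  rw [integral_integral_swap]
  · simp only [Function.update_comm hjl]
  · obtain ⟨C, hC⟩ := hF.bounded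
    refine Integrable.of_bound (hF.measurable.comp ?_).aestronglyMeasurable C
      (ae_of_all _ fun z => hC _)
    exact measurable_update'.comp
      (((measurable_update x).comp measurable_fst).prodMk measurable_snd)

end IsCylinder

lemma Disintegrates.mono [DecidableEq ι] {μ : Measure (ι → ℝ)} {κ : Kernel ℝ ℝ} {i j : ι}
    (h : Disintegrates μ κ i j B) (hAB : A ⊆ B) : Disintegrates μ κ i j A :=
  fun F hF => h F (hF.mono hAB)

protected lemma IsSupermodular.resample [DecidableEq ι] (hs : IsSupermodular F)
    (hF : IsCylinder F A) {κ : Kernel ℝ ℝ} [IsMarkovKernel κ]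
    (hκ : StochasticallyMonotoneOn κ univ) (i j : ι) :
    IsSupermodular (resample κ i j F) := by
  have hint (w : ι → ℝ) (u : ℝ) : Integrable (fun z => F (Function.update w j z)) (κ u) :=
    hF.integrable_update w j _
  have of_le (x y : ι → ℝ) (hxy : x i ≤ y i) :
      resample κ i j F x + resample κ i j F y ≤
        resample κ i j F (x ⊓ y) + resample κ i j F (x ⊔ y) := by
    have shift_kernel := hκ _ (mem_univ _) _ (mem_univ _) hxy _
      (hs.monotone_sub (le_sup_right : y ≤ x ⊔ y) j)
      ((hint _ _).sub (hint _ _)) ((hint _ _).sub (hint _ _))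
    have fixed_kernel := integral_mono ((hint x (x i)).add (hint y (x i)))
      ((hint (x ⊓ y) (x i)).add (hint (x ⊔ y) (x i))) fun z => hs.comp_update j z x y
    rw [integral_sub (hint _ _) (hint _ _), integral_sub (hint _ _) (hint _ _)] at shift_kernel
    rw [integral_add' (hint _ _) (hint _ _), integral_add' (hint _ _) (hint _ _)] at fixed_kernel
    simp only [resample, Pi.inf_apply, Pi.sup_apply, inf_eq_left.2 hxy, sup_eq_right.2 hxy]
    linarith
  intro x y
  rcases le_total (x i) (y i) with h | h
  · exact of_le x y h
  · simpa only [add_comm, inf_comm, sup_comm] using of_le y x h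

end Resampling

section Comparison

variable {μ ν : Measure (ℕ → ℝ)} {κ η : ℕ → Kernel ℝ ℝ} [∀ n, IsMarkovKernel (κ n)]
  [∀ n, IsMarkovKernel (η n)] {F : (ℕ → ℝ) → ℝ} {j k n : ℕ}

lemma IsCylinder.resample_last (hF : IsCylinder F (Icc j (k + 1))) (hjk : j ≤ k) (κ : Kernel ℝ ℝ)
    [IsMarkovKernel κ] : IsCylinder (resample κ k (k + 1) F) (Icc j k) :=
  hF.resample κ
    (fun i hi => by simp only [Set.mem_sdiff, mem_Icc, mem_singleton_iff] at hi ⊢; omega)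
    (right_mem_Icc.2 hjk)

lemma IsCylinder.resample_first (hF : IsCylinder F (Icc j k)) (hjk : j + 1 ≤ k) (κ : Kernel ℝ ℝ)
    [IsMarkovKernel κ] : IsCylinder (resample κ (j + 1) j F) (Icc (j + 1) k) :=
  hF.resample κ
    (fun i hi => by simp only [Set.mem_sdiff, mem_Icc, mem_singleton_iff] at hi ⊢; omega)
    (left_mem_Icc.2 hjk)

lemma resample_first_last_comm (hF : IsCylinder F (Icc j (k + 1))) (hjk : j + 1 ≤ k)
    (κ η : Kernel ℝ ℝ) [IsMarkovKernel κ] [IsMarkovKernel η] :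
    resample η (j + 1) j (resample κ k (k + 1) F) =
      resample κ k (k + 1) (resample η (j + 1) j F) :=
  hF.resample_comm η κ (by omega) (by omega) (by omega)

lemma integral_resample_first_last (hκ : ∀ n, Disintegrates μ (κ n) n (n + 1) (Iic (n + 1)))
    (hF : IsCylinder F (Icc j (k + 1))) (hjk : j + 1 ≤ k) (η : Kernel ℝ ℝ) [IsMarkovKernel η] :
    ∫ x, resample η (j + 1) j (resample (κ k) k (k + 1) F) x ∂μ =
      ∫ x, resample η (j + 1) j F x ∂μ := by
  rw [resample_first_last_comm hF hjk,
    ← hκ k _ ((hF.resample_first (by omega) η).mono Icc_subset_Iic_self)]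

/-- The Markov property is symmetric under time reversal. -/
lemma Disintegrates.backward {η : Kernel ℝ ℝ} [IsMarkovKernel η]
    (hκ : ∀ n, Disintegrates μ (κ n) n (n + 1) (Iic (n + 1)))
    (hη : Disintegrates μ η (n + 1) n (Icc n (n + 1))) (k : ℕ) :
    Disintegrates μ η (n + 1) n (Icc n k) := by
  refine Disintegrates.mono ?_ (Icc_subset_Icc_right (le_max_right (n + 1) k))
  generalize max (n + 1) k = k, le_max_left (n + 1) k = hnk
  induction k, hnk using Nat.le_induction with
  | base => exact hη
  | succ k hnk ih =>
    intro F hF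
    rw [hκ k F (hF.mono Icc_subset_Iic_self), ih _ (hF.resample_last (by omega) (κ k)),
      integral_resample_first_last hκ hF hnk]

/- The relation `r` stands for `≤` or `≥`. -/
variable {r : ℝ → ℝ → Prop}

lemma integral_resample_first_of_pair (hκ : ∀ n, Disintegrates μ (κ n) n (n + 1) (Iic (n + 1)))
    (hη : Disintegrates ν (η j) (j + 1) j (Icc j (j + 1)))
    (hκm : ∀ n, StochasticallyMonotoneOn (κ n) univ)
    (hmarg : ∀ n F, IsCylinder F {n} → ∫ x, F x ∂μ = ∫ x, F x ∂ν)
    (hpair : ∀ n F, IsCylinder F (Icc n (n + 1)) → IsSupermodular F →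
      r (∫ x, F x ∂μ) (∫ x, F x ∂ν))
    (hF : IsCylinder F (Icc j k)) (hs : IsSupermodular F) (hjk : j + 1 ≤ k) :
    r (∫ x, F x ∂μ) (∫ x, resample (η j) (j + 1) j F x ∂μ) := by
  induction k, hjk using Nat.le_induction generalizing F with
  | base =>
    have hres := hF.resample_first le_rfl (η j)
    rw [Icc_self] at hres
    rw [hmarg _ _ hres, ← hη F hF]
    exact hpair j F hF hs
  | succ k hjk ih =>
    rw [hκ k F (hF.mono Icc_subset_Iic_self), ← integral_resample_first_last hκ hF hjk]
    exact ih (hF.resample_last (by omega) (κ k)) (hs.resample hF (hκm k) _ _)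

/-- The first coordinate is decoupled by the backward transition of `ν`, one at a time. The
forward transitions of `μ` reduce each such replacement to a pair of neighbouring coordinates. -/
theorem integral_rel_of_stochasticallyMonotone [IsPreorder ℝ r]
    (hκ : ∀ n, Disintegrates μ (κ n) n (n + 1) (Iic (n + 1)))
    (hη : ∀ n, Disintegrates ν (η n) (n + 1) n (Icc n k))
    (hκm : ∀ n, StochasticallyMonotoneOn (κ n) univ)
    (hηm : ∀ n, StochasticallyMonotoneOn (η n) univ)
    (hmarg : ∀ n F, IsCylinder F {n} → ∫ x, F x ∂μ = ∫ x, F x ∂ν)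
    (hpair : ∀ n F, IsCylinder F (Icc n (n + 1)) → IsSupermodular F →
      r (∫ x, F x ∂μ) (∫ x, F x ∂ν))
    (hF : IsCylinder F (Icc j k)) (hs : IsSupermodular F) (hjk : j ≤ k) :
    r (∫ x, F x ∂μ) (∫ x, F x ∂ν) := by
  induction hjk using Nat.decreasingInduction generalizing F with
  | self =>
    rw [Icc_self] at hF
    rw [hmarg k F hF]
    exact refl_of r _
  | of_succ j hjk ih =>
    refine trans_of r (integral_resample_first_of_pair hκ
      ((hη j).mono (Icc_subset_Icc_right hjk)) hκm hmarg hpair hF hs hjk) ?_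
    rw [hη j F hF]
    exact ih (hF.resample_first hjk _) (hs.resample hF (hηm j) _ _)

end Comparison

/-- Under `μ` and within the coordinates `A`, the conditional law of the coordinate `j` given the
other ones depends on the coordinate `i` only and increases with it in the usual stochastic
order, outside a null set. -/
def ConditionallyIncreasing {ι : Type*} [DecidableEq ι] (μ : Measure (ι → ℝ)) (i j : ι)
    (A : Set ι) : Prop :=
  ∃ (κ : Kernel ℝ ℝ) (S : Set ℝ), IsMarkovKernel κ ∧ Disintegrates μ κ i j A ∧
    (∀ᵐ x ∂μ, x i ∈ S) ∧ StochasticallyMonotoneOn κ S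

/-- Truncation to the order interval `[a, b]`. -/
def clamp {α : Type*} [Lattice α] (a b x : α) : α := a ⊔ b ⊓ x

section Compactification

variable {ι : Type*} {μ : Measure (ι → ℝ)} {A : Set ι} {i j : ι}

lemma monotone_clamp {α : Type*} [Lattice α] (a b : α) : Monotone (clamp a b) :=
  fun _ _ h => sup_le_sup_left (inf_le_inf_left b h) a

lemma integral_map_pi {g : ℝ → ℝ} (hg : Measurable g) {F : (ι → ℝ) → ℝ} (hF : IsCylinder F A) :
    ∫ y, F y ∂μ.map (fun x k => g (x k)) = ∫ x, F (fun k => g (x k)) ∂μ :=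
  integral_map (measurable_pi_iff.2 fun k => hg.comp (measurable_pi_apply k)).aemeasurable
    hF.measurable.aestronglyMeasurable

variable [DecidableEq ι]

lemma Disintegrates.map {κ κ' : Kernel ℝ ℝ} [IsMarkovKernel κ'] (h : Disintegrates μ κ i j A)
    {g : ℝ → ℝ} (hg : Measurable g) (hκ' : ∀ᵐ x ∂μ, κ' (g (x i)) = (κ (x i)).map g) :
    Disintegrates (μ.map fun x k => g (x k)) κ' i j A := by
  intro F hF
  rw [integral_map_pi hg hF, integral_map_pi hg (hF.resample κ' (subset_univ _) (mem_univ i)),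
    h _ (hF.comp_pi fun _ => hg)]
  refine integral_congr_ae (hκ'.mono fun x hx => ?_)
  have hupd (z : ℝ) : (fun k => g (Function.update x j z k)) =
      Function.update (fun k => g (x k)) j (g z) :=
    funext fun k => Function.apply_update (fun _ => g) x j z k
  simp only [resample, hx, hupd]
  exact (integral_map hg.aemeasurable
    (hF.measurable.comp (measurable_update _)).aestronglyMeasurable).symm

/-- On the scale of the bounded function `arctan` the exceptional null set can be removed. -/
lemma ConditionallyIncreasing.exists_kernel (h : ConditionallyIncreasing μ i j A) :
    ∃ κ : Kernel ℝ ℝ, IsMarkovKernel κ ∧ StochasticallyMonotoneOn κ univ ∧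
      Disintegrates (μ.map fun x k => Real.arctan (x k)) κ i j A := by
  obtain ⟨κ, S, _, hdis, hS, hmono⟩ := h
  let p (u : ℝ) : Measure ℝ := (κ (Real.tan u)).map Real.arctan
  have hmono' : StochasticallyMonotoneOn p (Real.arctan '' S) := by
    rintro _ ⟨u, hu, rfl⟩ _ ⟨v, hv, rfl⟩ huv
    simp only [p, Real.tan_arctan]
    exact (hmono u hu v hv (Real.arctan_strictMono.le_iff_le.1 huv)).map
      Real.arctan_strictMono.monotone
  have hsupp (u : ℝ) : ∀ᵐ z ∂p u, z ∈ Icc (-(Real.pi / 2)) (Real.pi / 2) :=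
    (ae_map_iff Real.measurable_arctan.aemeasurable measurableSet_Icc).2 (ae_of_all _ fun x =>
      ⟨(Real.neg_pi_div_two_lt_arctan x).le, (Real.arctan_lt_pi_div_two x).le⟩)
  obtain ⟨κ', hκ', hκ'm, hκ'p⟩ := hmono'.exists_kernel
    (fun _ _ => Measure.isProbabilityMeasure_map Real.measurable_arctan.aemeasurable)
    fun u _ => hsupp u
  refine ⟨κ', hκ', hκ'm, hdis.map Real.measurable_arctan (hS.mono fun x hx => ?_)⟩
  simpa only [p, Real.tan_arctan] using hκ'p _ (mem_image_of_mem _ hx)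

/-- The inverse of `arctan`, truncated to a monotone function on `ℝ`. -/
noncomputable def clampTan (K y : ℝ) : ℝ :=
  Real.tan (clamp (Real.arctan (-K)) (Real.arctan K) y)

lemma clamp_mem_Icc {α : Type*} [Lattice α] {a b : α} (h : a ≤ b) (x : α) :
    clamp a b x ∈ Icc a b :=
  ⟨le_sup_left, sup_le h inf_le_left⟩

lemma monotone_clampTan {K : ℝ} (hK : 0 ≤ K) : Monotone (clampTan K) := by
  have hmem (y : ℝ) : clamp (Real.arctan (-K)) (Real.arctan K) y ∈
      Ioo (-(Real.pi / 2)) (Real.pi / 2) :=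
    Icc_subset_Ioo (Real.neg_pi_div_two_lt_arctan _) (Real.arctan_lt_pi_div_two _)
      (clamp_mem_Icc (Real.arctan_strictMono.monotone (neg_le_self hK)) y)
  exact fun y z hyz =>
    Real.strictMonoOn_tan.monotoneOn (hmem y) (hmem z) (monotone_clamp _ _ hyz)

lemma clampTan_arctan (K x : ℝ) : clampTan K (Real.arctan x) = clamp (-K) K x := by
  have hm := Real.arctan_strictMono.monotone
  rw [clampTan, clamp, ← hm.map_inf, ← hm.map_sup, Real.tan_arctan, clamp]

lemma integral_clamp_rel_of_conditionallyIncreasing {μ ν : Measure (ℕ → ℝ)} {F : (ℕ → ℝ) → ℝ}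
    {k : ℕ} {r : ℝ → ℝ → Prop} [IsPreorder ℝ r]
    (hμ : ∀ n, ConditionallyIncreasing μ n (n + 1) (Iic (n + 1)))
    (hν : ∀ n, ConditionallyIncreasing ν (n + 1) n (Icc n k))
    (hmarg : ∀ n F, IsCylinder F {n} → ∫ x, F x ∂μ = ∫ x, F x ∂ν)
    (hpair : ∀ n F, IsCylinder F (Icc n (n + 1)) → IsSupermodular F →
      r (∫ x, F x ∂μ) (∫ x, F x ∂ν))
    (hF : IsCylinder F (Icc 0 k)) (hs : IsSupermodular F) {K : ℝ} (hK : 0 ≤ K) :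
    r (∫ x, F (fun i => clamp (-K) K (x i)) ∂μ) (∫ x, F (fun i => clamp (-K) K (x i)) ∂ν) := by
  choose κ _ hκm hκ using fun n => (hμ n).exists_kernel
  choose η _ hηm hη using fun n => (hν n).exists_kernel
  have harctan := Real.measurable_arctan
  have htan := monotone_clampTan hK
  have hF' : IsCylinder (fun y => F fun i => clampTan K (y i)) (Icc 0 k) :=
    hF.comp_pi fun _ => htan.measurable
  simp only [← clampTan_arctan]
  rw [← integral_map_pi harctan hF', ← integral_map_pi harctan hF']
  refine integral_rel_of_stochasticallyMonotone hκ hη hκm hηm (fun n G hG => ?_)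
    (fun n G hG hGs => ?_) hF' (hs.comp_reindex id fun _ => htan) k.zero_le
  · rw [integral_map_pi harctan hG, integral_map_pi harctan hG]
    exact hmarg n _ (hG.comp_pi fun _ => harctan)
  · rw [integral_map_pi harctan hG, integral_map_pi harctan hG]
    exact hpair n _ (hG.comp_pi fun _ => harctan)
      (hGs.comp_reindex id fun _ => Real.arctan_strictMono.monotone)

end Compactification

section Clamping

lemma exists_ge_forall_le_two_mul {β : ℝ → ℝ} (hβ : ∀ x, 1 ≤ β x) (B : ℝ) :
    ∃ b ≥ B, ∀ y ≥ b, β b ≤ 2 * β y := by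
  have hlb : (1 : ℝ) ∈ lowerBounds (β '' Ici B) := by rintro _ ⟨x, -, rfl⟩; exact hβ x
  have hne : (β '' Ici B).Nonempty := ⟨_, B, self_mem_Ici, rfl⟩
  have hone : 1 ≤ sInf (β '' Ici B) := le_csInf hne hlb
  obtain ⟨_, ⟨b, hb, rfl⟩, hlt⟩ :=
    exists_lt_of_csInf_lt hne (by linarith : sInf (β '' Ici B) < 2 * sInf (β '' Ici B))
  refine ⟨b, hb, fun y hy => hlt.le.trans ?_⟩
  linarith [csInf_le ⟨1, hlb⟩ ⟨y, le_trans hb hy, rfl⟩]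

lemma exists_comp_clamp_le {β : ℝ → ℝ} (hβ : ∀ x, 1 ≤ β x) {B : ℝ} (hB : 0 ≤ B) :
    ∃ a b, a ≤ -B ∧ B ≤ b ∧ ∀ x, β (clamp a b x) ≤ 2 * β x := by
  obtain ⟨b, hb, hb2⟩ := exists_ge_forall_le_two_mul hβ B
  obtain ⟨a, ha, ha2⟩ := exists_ge_forall_le_two_mul (β := fun x => β (-x)) (fun x => hβ _) B
  refine ⟨-a, b, neg_le_neg ha, hb, fun x => ?_⟩
  rcases le_total x (-a) with hxa | hax
  · rw [clamp, sup_eq_left.2 (inf_le_right.trans hxa)]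
    simpa using ha2 (-x) (le_neg.1 hxa)
  · rcases le_total x b with hxb | hbx
    · rw [clamp, inf_eq_right.2 hxb, sup_eq_right.2 hax]
      linarith [hβ x]
    · rw [clamp, inf_eq_left.2 hbx, sup_eq_right.2 (by linarith)]
      exact hb2 x hbx

variable {ι : Type*}

lemma measurable_clamp (a b : ι → ℝ) : Measurable (clamp a b) :=
  measurable_pi_iff.2 fun k => (monotone_clamp (a k) (b k)).measurable.comp (measurable_pi_apply k)

lemma IsSupermodular.comp_clamp {f : (ι → ℝ) → ℝ} (hf : IsSupermodular f) (a b : ι → ℝ) :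
    IsSupermodular fun x => f (clamp a b x) :=
  hf.comp_reindex id fun k => monotone_clamp (a k) (b k)

variable [Finite ι] {lo hi : ℕ → ι → ℝ}

lemma eventually_clamp_eq (hlo : ∀ N k, lo N k ≤ -N) (hhi : ∀ N k, N ≤ hi N k) (x : ι → ℝ) :
    ∀ᶠ N in atTop, clamp (lo N) (hi N) x = x := by
  have hx (k : ι) : ∀ᶠ N : ℕ in atTop, |x k| ≤ N :=
    tendsto_natCast_atTop_atTop.eventually_ge_atTop _
  filter_upwards [eventually_all.2 hx] with N hN
  ext k
  obtain ⟨h₁, h₂⟩ := abs_le.1 (hN k)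
  change lo N k ⊔ hi N k ⊓ x k = x k
  rw [inf_eq_right.2 (h₂.trans (hhi N k)), sup_eq_right.2 ((hlo N k).trans h₁)]

lemma tendsto_integral_comp_clamp {ρ : Measure (ι → ℝ)} {f g : (ι → ℝ) → ℝ} (hf : Measurable f)
    (hlo : ∀ N k, lo N k ≤ -N) (hhi : ∀ N k, N ≤ hi N k) (hg : Integrable g ρ)
    (hfg : ∀ N x, |f (clamp (lo N) (hi N) x)| ≤ g x) :
    Tendsto (fun N => ∫ x, f (clamp (lo N) (hi N) x) ∂ρ) atTop (𝓝 (∫ x, f x ∂ρ)) :=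
  tendsto_integral_of_dominated_convergence g
    (fun _ => (hf.comp (measurable_clamp _ _)).aestronglyMeasurable) hg
    (fun N => ae_of_all _ (hfg N)) (ae_of_all _ fun x =>
      tendsto_const_nhds.congr'
        ((eventually_clamp_eq hlo hhi x).mono fun _ hN => congrArg f hN.symm))

end Clamping

section BoundedOrder

variable {d : ℕ} {μ ν : Measure (Fin d → ℝ)} {b : (Fin d → ℝ) → ℝ}

lemma supermodularLE_one_iff [IsFiniteMeasure μ] [IsFiniteMeasure ν] :
    SupermodularLE 1 μ ν ↔ ∀ f : (Fin d → ℝ) → ℝ, Measurable f → IsSupermodular f →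
      (∃ C, ∀ x, |f x| ≤ C) → ∫ x, f x ∂μ ≤ ∫ x, f x ∂ν := by
  simp only [SupermodularLE, Pi.one_apply, mul_one]
  exact ⟨fun h => h.2.2, fun h => ⟨integrable_const 1, integrable_const 1, h⟩⟩

lemma SupermodularLE.to_one [IsFiniteMeasure μ] [IsFiniteMeasure ν] (hb : IsWeight b)
    (h : SupermodularLE b μ ν) : SupermodularLE 1 μ ν :=
  supermodularLE_one_iff.2 fun f hfm hf ⟨C, hC⟩ => h.2.2 f hfm hf ⟨C, fun x =>
    (hC x).trans (le_mul_of_one_le_right ((abs_nonneg _).trans (hC x)) (hb.2 x))⟩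

/-- Both signs of a function of one coordinate are supermodular. -/
lemma SupermodularLE.map_eval_eq [IsProbabilityMeasure μ] [IsProbabilityMeasure ν]
    (h : SupermodularLE 1 μ ν) (k : Fin d) : μ.map (fun x => x k) = ν.map fun x => x k := by
  have integral_le {u : ℝ → ℝ} (hu : Measurable u) (hub : ∃ C, ∀ v, |u v| ≤ C) :
      ∫ x, u (x k) ∂μ ≤ ∫ x, u (x k) ∂ν :=
    supermodularLE_one_iff.1 h _ (hu.comp (measurable_pi_apply k))
      (fun x y => (fn_min_add_fn_max u (x k) (y k)).ge) (hub.imp fun C hC x => hC _)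
  ext B hB
  have hev : Measurable fun x : Fin d → ℝ => x k := measurable_pi_apply k
  have hind : Measurable (B.indicator fun _ => (1 : ℝ)) := measurable_const.indicator hB
  have hbound (v : ℝ) : |B.indicator (fun _ => (1 : ℝ)) v| ≤ 1 := by
    by_cases hv : v ∈ B <;> simp [hv]
  have hle := integral_le hind ⟨1, hbound⟩
  have hge := integral_le hind.neg ⟨1, fun v => by simpa using hbound v⟩
  simp only [Pi.neg_apply, integral_neg, neg_le_neg_iff] at hge
  have hprob (ρ : Measure (Fin d → ℝ)) :
      ∫ x, B.indicator (fun _ => (1 : ℝ)) (x k) ∂ρ = (ρ.map fun x => x k).real B := by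
    rw [← integral_map hev.aemeasurable hind.aestronglyMeasurable,
      integral_indicator_const _ hB, smul_eq_mul, mul_one]
  have := Measure.isProbabilityMeasure_map (μ := μ) hev.aemeasurable
  have := Measure.isProbabilityMeasure_map (μ := ν) hev.aemeasurable
  rw [hprob, hprob] at hle hge
  exact (measureReal_eq_measureReal_iff).1 (le_antisymm hle hge)

/-- The difference of `f` and its additive approximation along the axes through `a`. -/
noncomputable def interaction (f : (Fin d → ℝ) → ℝ) (a x : Fin d → ℝ) : ℝ :=
  f x - ∑ k, (f (Function.update a k (x k)) - f a)

variable {f : (Fin d → ℝ) → ℝ}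

lemma measurable_interaction (hf : Measurable f) (a : Fin d → ℝ) : Measurable (interaction f a) :=
  hf.sub (Finset.measurable_fun_sum _ fun k _ =>
    (hf.comp ((measurable_update a).comp (measurable_pi_apply k))).sub_const _)

lemma isSupermodular_interaction (hf : IsSupermodular f) (a : Fin d → ℝ) :
    IsSupermodular (interaction f a) := by
  intro x y
  have modular := Finset.sum_congr rfl fun k (_ : k ∈ Finset.univ) =>
    fn_min_add_fn_max (fun v => f (Function.update a k v)) (x k) (y k)
  simp only [Finset.sum_add_distrib] at modular
  simp only [interaction, Finset.sum_sub_distrib, Pi.inf_apply, Pi.sup_apply]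
  linarith [hf x y]

lemma IsSupermodular.interaction_mono (hf : IsSupermodular f) {a x y : Fin d → ℝ} (hax : a ≤ x)
    (hxy : x ≤ y) : interaction f a x ≤ interaction f a y := by
  have h := hf.sum_sub_le hax hxy
  simp only [interaction, Finset.sum_sub_distrib] at h ⊢
  linarith

lemma IsSupermodular.exists_abs_interaction_clamp_le (hf : IsSupermodular f) {lo hi : Fin d → ℝ}
    (hlh : lo ≤ hi) : ∃ C, ∀ x, |interaction f lo (clamp lo hi x)| ≤ C :=
  ⟨max |interaction f lo lo| |interaction f lo hi|, fun x =>
    abs_le_max_abs_abs (hf.interaction_mono le_rfl (clamp_mem_Icc hlh x).1)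
      (hf.interaction_mono (clamp_mem_Icc hlh x).1 (clamp_mem_Icc hlh x).2)⟩

variable [IsProbabilityMeasure μ] [IsProbabilityMeasure ν]

lemma SupermodularLE.integral_comp_clamp_le (h : SupermodularLE 1 μ ν) (hfm : Measurable f)
    (hf : IsSupermodular f) {lo hi : Fin d → ℝ} (hlh : lo ≤ hi)
    (hμ : ∀ k, Integrable (fun x => f (Function.update lo k (clamp lo hi x k))) μ)
    (hν : ∀ k, Integrable (fun x => f (Function.update lo k (clamp lo hi x k))) ν) :
    ∫ x, f (clamp lo hi x) ∂μ ≤ ∫ x, f (clamp lo hi x) ∂ν := by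
  let F (x : Fin d → ℝ) : ℝ := interaction f lo (clamp lo hi x)
  let g (k : Fin d) (v : ℝ) : ℝ := f (Function.update lo k (clamp (lo k) (hi k) v))
  have hFm : Measurable F := (measurable_interaction hfm lo).comp (measurable_clamp _ _)
  have hFb : ∃ C, ∀ x, |F x| ≤ C := hf.exists_abs_interaction_clamp_le hlh
  have hF : ∫ x, F x ∂μ ≤ ∫ x, F x ∂ν :=
    supermodularLE_one_iff.1 h F hFm ((isSupermodular_interaction hf lo).comp_clamp lo hi) hFb
  have hg (k : Fin d) : ∫ x, g k (x k) ∂μ = ∫ x, g k (x k) ∂ν := by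
    have hgm : Measurable (g k) :=
      hfm.comp ((measurable_update lo).comp (monotone_clamp _ _).measurable)
    have hev : Measurable fun x : Fin d → ℝ => x k := measurable_pi_apply k
    rw [← integral_map hev.aemeasurable hgm.aestronglyMeasurable, h.map_eval_eq,
      integral_map hev.aemeasurable hgm.aestronglyMeasurable]
  have split (ρ : Measure (Fin d → ℝ)) [IsProbabilityMeasure ρ]
      (hρ : ∀ k, Integrable (fun x => g k (x k)) ρ) :
      ∫ x, f (clamp lo hi x) ∂ρ = ∫ x, F x ∂ρ + ∑ k, (∫ x, g k (x k) ∂ρ - f lo) := by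
    have hFi : Integrable F ρ := Integrable.of_bound hFm.aestronglyMeasurable _
      (ae_of_all _ hFb.choose_spec)
    have hgi (k : Fin d) : Integrable (fun x => g k (x k) - f lo) ρ :=
      (hρ k).sub (integrable_const _)
    have hsum (x : Fin d → ℝ) : f (clamp lo hi x) = F x + ∑ k, (g k (x k) - f lo) :=
      (sub_add_cancel _ _).symm
    simp only [hsum]
    rw [integral_add hFi (integrable_finsetSum _ fun k _ => hgi k),
      integral_finsetSum _ fun k _ => hgi k]
    simp [integral_sub (hρ _) (integrable_const _)]
  rw [split μ hμ, split ν hν]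
  simpa only [hg, add_le_add_iff_right] using hF

lemma integrable_of_abs_le_sum {ρ : Measure (Fin d → ℝ)} [IsFiniteMeasure ρ] (hf : Measurable f)
    {c : ℝ} {β : Fin d → ℝ → ℝ} (hβ : ∀ k, Integrable (β k) (ρ.map fun x => x k))
    (hfβ : ∀ x, |f x| ≤ c + ∑ k, β k (x k)) : Integrable f ρ :=
  Integrable.mono' ((integrable_const c).add (integrable_finsetSum _ fun k _ =>
    (hβ k).comp_measurable (measurable_pi_apply k))) hf.aestronglyMeasurable (ae_of_all _ hfβ)

lemma SupermodularLE.integral_le_of_abs_le_sum (h : SupermodularLE 1 μ ν) (hfm : Measurable f)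
    (hf : IsSupermodular f) {c : ℝ} {β : Fin d → ℝ → ℝ} (hβ : ∀ k v, 1 ≤ β k v)
    (hβμ : ∀ k, Integrable (β k) (μ.map fun x => x k)) (hfβ : ∀ x, |f x| ≤ c + ∑ k, β k (x k)) :
    ∫ x, f x ∂μ ≤ ∫ x, f x ∂ν := by
  have hβν (k : Fin d) : Integrable (β k) (ν.map fun x => x k) := h.map_eval_eq k ▸ hβμ k
  choose lo hi hlo hhi hcl using fun (N : ℕ) (k : Fin d) =>
    exists_comp_clamp_le (hβ k) (Nat.cast_nonneg (α := ℝ) N)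
  have hlh (N : ℕ) : lo N ≤ hi N := fun k => by
    linarith [hlo N k, hhi N k, Nat.cast_nonneg (α := ℝ) N]
  have hdom (N : ℕ) (x : Fin d → ℝ) :
      |f (clamp (lo N) (hi N) x)| ≤ c + ∑ k, 2 * β k (x k) :=
    (hfβ _).trans (by gcongr with k; exact hcl N k _)
  have haxis (N : ℕ) (k : Fin d) (x : Fin d → ℝ) :
      |f (Function.update (lo N) k (clamp (lo N) (hi N) x k))| ≤
        c + ∑ l, (β l (lo N l) + 2 * β l (x l)) := by
    refine (hfβ _).trans (add_le_add_right (Finset.sum_le_sum fun l _ => ?_) c)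
    rcases eq_or_ne l k with rfl | hlk
    · rw [Function.update_self]
      exact (hcl N l (x l)).trans (le_add_of_nonneg_left (zero_le_one.trans (hβ l _)))
    · rw [Function.update_of_ne hlk]
      linarith [hβ l (x l)]
  have haxis_int (ρ : Measure (Fin d → ℝ)) [IsProbabilityMeasure ρ]
      (hρ : ∀ k, Integrable (β k) (ρ.map fun x => x k)) (N : ℕ) (k : Fin d) :
      Integrable (fun x => f (Function.update (lo N) k (clamp (lo N) (hi N) x k))) ρ :=
    integrable_of_abs_le_sum (β := fun l v => β l (lo N l) + 2 * β l v)
      (hfm.comp ((measurable_update _).comp ((measurable_pi_apply k).comp (measurable_clamp _ _))))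
      (fun l => (integrable_const _).add ((hρ l).const_mul 2)) (haxis N k)
  have hlim (ρ : Measure (Fin d → ℝ)) [IsProbabilityMeasure ρ]
      (hρ : ∀ k, Integrable (β k) (ρ.map fun x => x k)) :
      Tendsto (fun N => ∫ x, f (clamp (lo N) (hi N) x) ∂ρ) atTop (𝓝 (∫ x, f x ∂ρ)) :=
    tendsto_integral_comp_clamp hfm hlo hhi ((integrable_const c).add
      (integrable_finsetSum _ fun k _ =>
        ((hρ k).comp_measurable (measurable_pi_apply k)).const_mul 2)) hdom
  exact le_of_tendsto_of_tendsto' (hlim μ hβμ) (hlim ν hβν) fun N =>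
    h.integral_comp_clamp_le hfm hf (hlh N) (haxis_int μ hβμ N) (haxis_int ν hβν N)

theorem SupermodularLE.of_one (h : SupermodularLE 1 μ ν) (hb : IsWeight b) {c : ℝ}
    {β : Fin d → ℝ → ℝ} (hβ : ∀ k, Integrable (β k) (μ.map fun x => x k))
    (hbβ : ∀ x, b x ≤ c + ∑ k, β k (x k)) : SupermodularLE b μ ν := by
  have habs (x : Fin d → ℝ) : |b x| ≤ c + ∑ k, β k (x k) :=
    (abs_of_nonneg (zero_le_one.trans (hb.2 x))).trans_le (hbβ x)
  refine ⟨integrable_of_abs_le_sum hb.1 hβ habs,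
    integrable_of_abs_le_sum hb.1 (fun k => h.map_eval_eq k ▸ hβ k) habs, ?_⟩
  rintro f hfm hf ⟨C, hC⟩
  refine h.integral_le_of_abs_le_sum hfm hf (c := |C| * c) (β := fun k v => 1 + |C| * |β k v|)
    (fun k v => le_add_of_nonneg_right (by positivity))
    (fun k => (integrable_const 1).add ((hβ k).abs.const_mul |C|)) fun x => ?_
  calc |f x| ≤ C * b x := hC x
    _ ≤ |C| * (c + ∑ k, β k (x k)) :=
      mul_le_mul (le_abs_self C) (hbβ x) (zero_le_one.trans (hb.2 x)) (abs_nonneg C)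
    _ ≤ |C| * c + ∑ k, (1 + |C| * |β k (x k)|) := by
      rw [mul_add, Finset.mul_sum]
      gcongr with k
      nlinarith [le_abs_self (β k (x k)), abs_nonneg C]

end BoundedOrder

section ProcessOrder

variable {μ ν : Measure (ℕ → ℝ)}

lemma IsCylinder.integral_eq_of_map_eval_eq {n : ℕ} {F : (ℕ → ℝ) → ℝ} (hF : IsCylinder F {n})
    (h : μ.map (fun x => x n) = ν.map fun x => x n) : ∫ x, F x ∂μ = ∫ x, F x ∂ν := by
  have hconst : Measurable fun u : ℝ => F fun _ => u :=
    hF.measurable.comp (measurable_pi_iff.2 fun _ => measurable_id)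
  have hF_eq (x : ℕ → ℝ) : F (fun _ => x n) = F x :=
    hF.dependsOn fun k hk => congrArg x (mem_singleton_iff.1 hk).symm
  have integral_eq (ρ : Measure (ℕ → ℝ)) :
      ∫ x, F x ∂ρ = ∫ u, F (fun _ => u) ∂ρ.map fun x => x n := by
    rw [integral_map (measurable_pi_apply n).aemeasurable hconst.aestronglyMeasurable]
    simp only [hF_eq]
  rw [integral_eq, integral_eq, h]

lemma measurable_consecutive (n : ℕ) : Measurable fun x : ℕ → ℝ => ![x n, x (n + 1)] :=
  measurable_pi_iff.2 (Fin.forall_fin_two.2 ⟨measurable_pi_apply n, measurable_pi_apply (n + 1)⟩)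

lemma measurable_reindex {ι : Type*} (σ : ι → ℕ) :
    Measurable fun (x : ℕ → ℝ) k => x (σ k) :=
  measurable_pi_iff.2 fun k => measurable_pi_apply (σ k)

variable [IsProbabilityMeasure μ] [IsProbabilityMeasure ν]

lemma integral_le_of_supermodularLE_consecutive {n : ℕ} (h : SupermodularLE 1
    (μ.map fun x => ![x n, x (n + 1)]) (ν.map fun x => ![x n, x (n + 1)])) {F : (ℕ → ℝ) → ℝ}
    (hF : IsCylinder F (Icc n (n + 1))) (hs : IsSupermodular F) :
    ∫ x, F x ∂μ ≤ ∫ x, F x ∂ν := by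
  have hpair := measurable_consecutive n
  have := Measure.isProbabilityMeasure_map (μ := μ) hpair.aemeasurable
  have := Measure.isProbabilityMeasure_map (μ := ν) hpair.aemeasurable
  let σ (k : ℕ) : Fin 2 := if k = n + 1 then 1 else 0
  have hfm : Measurable fun v : Fin 2 → ℝ => F fun k => v (σ k) :=
    hF.measurable.comp (measurable_pi_iff.2 fun k => measurable_pi_apply (σ k))
  have hfs : IsSupermodular fun v : Fin 2 → ℝ => F fun k => v (σ k) :=
    hs.comp_reindex σ fun _ => monotone_id
  have hF_eq (x : ℕ → ℝ) : F (fun k => ![x n, x (n + 1)] (σ k)) = F x :=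
    hF.dependsOn fun k hk => by
      obtain rfl | rfl : k = n ∨ k = n + 1 := by have := hk.1; have := hk.2; omega
      · simp [σ]
      · simp [σ]
  have hle := supermodularLE_one_iff.1 h _ hfm hfs (hF.bounded.imp fun C hC v => hC _)
  rw [integral_map hpair.aemeasurable hfm.aestronglyMeasurable,
    integral_map hpair.aemeasurable hfm.aestronglyMeasurable] at hle
  simpa only [hF_eq] using hle

lemma map_eval_eq_of_supermodularLE_consecutive {n : ℕ} (h : SupermodularLE 1
    (μ.map fun x => ![x n, x (n + 1)]) (ν.map fun x => ![x n, x (n + 1)])) :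
    μ.map (fun x => x n) = ν.map fun x => x n := by
  have hpair := measurable_consecutive n
  have := Measure.isProbabilityMeasure_map (μ := μ) hpair.aemeasurable
  have := Measure.isProbabilityMeasure_map (μ := ν) hpair.aemeasurable
  have heq := h.map_eval_eq 0
  rwa [Measure.map_map (measurable_pi_apply 0) hpair,
    Measure.map_map (measurable_pi_apply 0) hpair] at heq

lemma integral_rel_of_conditionallyIncreasing {r : ℝ → ℝ → Prop} [IsPreorder ℝ r]
    (hr : IsClosed {p : ℝ × ℝ | r p.1 p.2})
    (hμ : ∀ n, ConditionallyIncreasing μ n (n + 1) (Iic (n + 1)))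
    (hν : ∀ n k, ConditionallyIncreasing ν (n + 1) n (Icc n k))
    (hmarg : ∀ n, μ.map (fun x => x n) = ν.map fun x => x n)
    (hpair : ∀ n F, IsCylinder F (Icc n (n + 1)) → IsSupermodular F →
      r (∫ x, F x ∂μ) (∫ x, F x ∂ν))
    {ι : Type*} [Finite ι] (σ : ι → ℕ) {f : (ι → ℝ) → ℝ} (hfm : Measurable f)
    (hf : IsSupermodular f) {C : ℝ} (hC : ∀ x, |f x| ≤ C) :
    r (∫ y, f y ∂μ.map fun x k => x (σ k)) (∫ y, f y ∂ν.map fun x k => x (σ k)) := by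
  have := Fintype.ofFinite ι
  have hσ := measurable_reindex σ
  have hF : IsCylinder (fun x : ℕ → ℝ => f fun k => x (σ k)) (Icc 0 (Finset.univ.sup σ)) :=
    ⟨hfm.comp hσ, ⟨C, fun x => hC _⟩, fun x y hxy => congrArg f (funext fun k =>
      hxy _ ⟨Nat.zero_le _, Finset.le_sup (Finset.mem_univ k)⟩)⟩
  have hclamp (N : ℕ) := integral_clamp_rel_of_conditionallyIncreasing hμ (fun n => hν n _)
    (fun n F hF => hF.integral_eq_of_map_eval_eq (hmarg n)) hpair hF
    (hf.comp_reindex σ fun _ => monotone_id) N.cast_nonneg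
  have hlim (ρ : Measure (ℕ → ℝ)) [IsProbabilityMeasure ρ] :
      Tendsto (fun N : ℕ => ∫ x, f (fun k => clamp (-N : ℝ) N (x (σ k))) ∂ρ) atTop
        (𝓝 (∫ y, f y ∂ρ.map fun x k => x (σ k))) := by
    have := Measure.isProbabilityMeasure_map (μ := ρ) hσ.aemeasurable
    have hlim := tendsto_integral_comp_clamp (ρ := ρ.map fun x k => x (σ k))
      (lo := fun N _ => -N) (hi := fun N _ => N) hfm (fun _ _ => le_rfl) (fun _ _ => le_rfl)
      (integrable_const C) fun N x => hC _
    refine hlim.congr fun N => ?_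
    exact integral_map hσ.aemeasurable (hfm.comp (measurable_clamp _ _)).aestronglyMeasurable
  exact hr.mem_of_tendsto ((hlim μ).prodMk_nhds (hlim ν)) (Eventually.of_forall hclamp)

variable (hμ : ∀ n, ConditionallyIncreasing μ n (n + 1) (Iic (n + 1)))
  (hν : ∀ n k, ConditionallyIncreasing ν (n + 1) n (Icc n k))
include hμ hν

theorem processSupermodularLE_one_of_consecutive_le
    (h : ∀ n, SupermodularLE 1 (μ.map fun x => ![x n, x (n + 1)])
      (ν.map fun x => ![x n, x (n + 1)])) : ProcessSupermodularLE 1 μ ν := by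
  intro m σ
  have := Measure.isProbabilityMeasure_map (μ := μ) (measurable_reindex σ).aemeasurable
  have := Measure.isProbabilityMeasure_map (μ := ν) (measurable_reindex σ).aemeasurable
  exact supermodularLE_one_iff.2 fun f hfm hf ⟨C, hC⟩ =>
    integral_rel_of_conditionallyIncreasing (r := (· ≤ ·))
      (isClosed_le continuous_fst continuous_snd) hμ hν
      (fun n => map_eval_eq_of_supermodularLE_consecutive (h n))
      (fun n _ => integral_le_of_supermodularLE_consecutive (h n)) σ hfm hf hC

theorem processSupermodularLE_one_of_consecutive_ge
    (h : ∀ n, SupermodularLE 1 (ν.map fun x => ![x n, x (n + 1)])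
      (μ.map fun x => ![x n, x (n + 1)])) : ProcessSupermodularLE 1 ν μ := by
  intro m σ
  have := Measure.isProbabilityMeasure_map (μ := μ) (measurable_reindex σ).aemeasurable
  have := Measure.isProbabilityMeasure_map (μ := ν) (measurable_reindex σ).aemeasurable
  exact supermodularLE_one_iff.2 fun f hfm hf ⟨C, hC⟩ =>
    integral_rel_of_conditionallyIncreasing (r := (· ≥ ·))
      (isClosed_le continuous_snd continuous_fst) hμ hν
      (fun n => (map_eval_eq_of_supermodularLE_consecutive (h n)).symm)
      (fun n _ => integral_le_of_supermodularLE_consecutive (h n)) σ hfm hf hC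

end ProcessOrder

section Markov

lemma map_prodMk_eq_compProd_of_condExp {Ω α β γ : Type*} {m mΩ : MeasurableSpace Ω}
    [MeasurableSpace α] [MeasurableSpace β] [MeasurableSpace γ] [StandardBorelSpace γ] [Nonempty γ]
    {P : Measure Ω} [IsProbabilityMeasure P] (hm : m ≤ mΩ) {U : Ω → β} {V : Ω → γ}
    (hU : Measurable U) (hV : Measurable V) {H : Ω → α} (hH : Measurable[m] H) {g : α → β}
    (hg : Measurable g) (hgH : ∀ ω, g (H ω) = U ω)
    (hM : ∀ B, MeasurableSet B →
      P⟦V ⁻¹' B | m⟧ =ᵐ[P] P⟦V ⁻¹' B | MeasurableSpace.comap U inferInstance⟧) :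
    P.map (fun ω => (H ω, V ω)) = P.map H ⊗ₘ (condDistrib V U P).comap g hg := by
  have hH' : Measurable H := hH.mono hm le_rfl
  have := Measure.isProbabilityMeasure_map (μ := P) hH'.aemeasurable
  refine Measure.ext_prod fun {s t} hs ht => ?_
  have hκ : Measurable fun ω => condDistrib V U P (U ω) t := (Kernel.measurable_coe _ ht).comp hU
  have hsm : MeasurableSet[m] (H ⁻¹' s) := hH hs
  have hcond : (fun ω => (condDistrib V U P (U ω)).real t) =ᵐ[P] P⟦V ⁻¹' t | m⟧ :=
    (condDistrib_ae_eq_condExp hU hV ht).trans (hM t ht).symm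
  have hreal : P.real (H ⁻¹' s ∩ V ⁻¹' t) =
      ∫ ω in H ⁻¹' s, (condDistrib V U P (U ω)).real t ∂P := by
    rw [setIntegral_congr_ae (hm _ hsm) (hcond.mono fun ω h _ => h),
      setIntegral_condExp hm ((integrable_const _).indicator (hV ht)) hsm,
      integral_indicator_const _ (hV ht)]
    simp [measureReal_restrict_apply (hV ht), inter_comm]
  have hfin : ∫⁻ ω in H ⁻¹' s, condDistrib V U P (U ω) t ∂P ≠ ⊤ :=
    ((lintegral_mono fun ω => prob_le_one).trans_lt (by simp)).ne
  rw [Measure.map_apply (hH'.prodMk hV) (hs.prod ht), Measure.compProd_apply_prod hs ht,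
    setLIntegral_map hs (Kernel.measurable_coe _ ht) hH']
  simp only [Kernel.comap_apply, hgH]
  rw [← ENNReal.toReal_eq_toReal_iff' (measure_ne_top _ _) hfin, ← integral_toReal
    hκ.aemeasurable (ae_of_all _ fun ω => measure_lt_top _ _)]
  exact hreal

variable {Ω Ω' : Type*} {mΩ : MeasurableSpace Ω} [MeasurableSpace Ω'] {P : Measure Ω}
  {Q : Measure Ω'} {X : ℕ → Ω → ℝ} {Y : ℕ → Ω' → ℝ} {i j : ℕ} {A : Set ℕ}

lemma integral_processLaw (hX : ∀ i, Measurable (X i)) {F : (ℕ → ℝ) → ℝ} (hF : Measurable F) :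
    ∫ x, F x ∂processLaw P X = ∫ ω, F (fun i => X i ω) ∂P :=
  integral_map (measurable_pi_iff.2 hX).aemeasurable hF.aestronglyMeasurable

lemma map_eval_processLaw (hX : ∀ i, Measurable (X i)) (i : ℕ) :
    (processLaw P X).map (fun x => x i) = P.map (X i) :=
  Measure.map_map (measurable_pi_apply i) (measurable_pi_iff.2 hX)

lemma map_consecutive_processLaw (hX : ∀ i, Measurable (X i)) (i : ℕ) :
    (processLaw P X).map (fun x => ![x i, x (i + 1)]) = consecutiveLaw P X i :=
  Measure.map_map (measurable_consecutive i) (measurable_pi_iff.2 hX)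

variable [IsProbabilityMeasure P] [IsProbabilityMeasure Q]

lemma isProbabilityMeasure_processLaw (hX : ∀ i, Measurable (X i)) :
    IsProbabilityMeasure (processLaw P X) :=
  Measure.isProbabilityMeasure_map (measurable_pi_iff.2 hX).aemeasurable

lemma isProbabilityMeasure_consecutiveLaw (hX : ∀ i, Measurable (X i)) (i : ℕ) :
    IsProbabilityMeasure (consecutiveLaw P X i) :=
  Measure.isProbabilityMeasure_map
    ((measurable_consecutive i).comp (measurable_pi_iff.2 hX)).aemeasurable

lemma disintegrates_of_map_prodMk_eq (hX : ∀ i, Measurable (X i)) {κ : Kernel ℝ ℝ}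
    [IsMarkovKernel κ] {H : Ω → ℕ → ℝ} (hH : Measurable H)
    (hlaw : P.map (fun ω => (H ω, X j ω)) =
      P.map H ⊗ₘ κ.comap (fun x => x i) (measurable_pi_apply i))
    (hHX : ∀ k ∈ insert i (A \ {j}), ∀ ω, H ω k = X k ω) :
    Disintegrates (processLaw P X) κ i j A := by
  intro F hF
  have hFm : Measurable fun p : (ℕ → ℝ) × ℝ => F (Function.update p.1 j p.2) :=
    hF.measurable.comp measurable_update'
  have hres : Measurable (resample κ i j F) :=
    (hF.resample κ (subset_univ _) (mem_univ i)).measurable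
  have hi (ω : Ω) : H ω i = X i ω := hHX i (mem_insert i _) ω
  have hupd (ω : Ω) (z : ℝ) :
      F (Function.update (H ω) j z) = F (Function.update (fun k => X k ω) j z) := by
    refine hF.dependsOn fun k hk => ?_
    rcases eq_or_ne k j with rfl | hkj
    · simp only [Function.update_self]
    · simp only [Function.update_of_ne hkj, hHX k (mem_insert_of_mem _ ⟨hk, hkj⟩) ω]
  have := Measure.isProbabilityMeasure_map (μ := P) hH.aemeasurable
  calc ∫ x, F x ∂processLaw P X = ∫ ω, F (fun k => X k ω) ∂P :=
        integral_processLaw hX hF.measurable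
    _ = ∫ ω, F (Function.update (H ω) j (X j ω)) ∂P := by
        simp only [hupd, Function.update_eq_self_iff.2]
    _ = ∫ p, F (Function.update p.1 j p.2) ∂P.map (fun ω => (H ω, X j ω)) :=
        (integral_map (hH.prodMk (hX j)).aemeasurable hFm.aestronglyMeasurable).symm
    _ = ∫ x, resample κ i j F x ∂P.map H := by
        obtain ⟨C, hC⟩ := hF.bounded
        rw [hlaw, Measure.integral_compProd (Integrable.of_bound hFm.aestronglyMeasurable C
          (ae_of_all _ fun p => hC _))]
        rfl
    _ = ∫ ω, resample κ i j F (fun k => X k ω) ∂P := by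
        rw [integral_map hH.aemeasurable hres.aestronglyMeasurable]
        simp only [resample, hupd, hi]
    _ = ∫ x, resample κ i j F x ∂processLaw P X := (integral_processLaw hX hres).symm

lemma disintegrates_condDistrib {Ω : Type*} {m mΩ : MeasurableSpace Ω} {P : Measure Ω}
    [IsProbabilityMeasure P] {X : ℕ → Ω → ℝ} (hm : m ≤ mΩ) (hX : ∀ i, Measurable (X i))
    (hXm : ∀ k ∈ insert i (A \ {j}), Measurable[m] (X k))
    (hM : ∀ B, MeasurableSet B →
      P⟦X j ⁻¹' B | m⟧ =ᵐ[P] P⟦X j ⁻¹' B | MeasurableSpace.comap (X i) inferInstance⟧) :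
    Disintegrates (processLaw P X) (condDistrib (X j) (X i) P) i j A := by
  classical
  let H : Ω → ℕ → ℝ := fun ω k => if k ∈ insert i (A \ {j}) then X k ω else 0
  have hHX : ∀ k ∈ insert i (A \ {j}), ∀ ω, H ω k = X k ω := fun k hk ω => if_pos hk
  have hH : Measurable[m] H := (@measurable_pi_iff _ _ _ m _ _).2 fun k => by
    by_cases hk : k ∈ insert i (A \ {j})
    · simpa only [H, if_pos hk] using hXm k hk
    · simpa only [H, if_neg hk] using @measurable_const _ _ _ m 0
  exact disintegrates_of_map_prodMk_eq hX (hH.mono hm le_rfl)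
    (map_prodMk_eq_compProd_of_condExp hm (hX i) (hX j) hH (measurable_pi_apply i)
      (hHX i (mem_insert i _)) hM) hHX

namespace IsMarkovProcess

lemma disintegrates (hX : IsMarkovProcess P X) (n : ℕ) :
    Disintegrates (processLaw P X) (condDistrib (X (n + 1)) (X n) P) n (n + 1) (Iic (n + 1)) := by
  refine disintegrates_condDistrib (iSup₂_le fun j _ => (hX.1 j).comap_le) hX.1
    (fun k hk => (comap_measurable (X k)).mono ?_ le_rfl) (hX.2 n)
  have hkn : k ≤ n := by
    simp only [mem_insert_iff, Set.mem_sdiff, mem_Iic, mem_singleton_iff] at hk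
    omega
  exact le_iSup₂ (f := fun j (_ : j ≤ n) => MeasurableSpace.comap (X j) inferInstance) k hkn

lemma disintegrates_backward (hX : IsMarkovProcess P X) (n k : ℕ) :
    Disintegrates (processLaw P X) (condDistrib (X n) (X (n + 1)) P) (n + 1) n (Icc n k) := by
  refine Disintegrates.backward hX.disintegrates
    (disintegrates_condDistrib (hX.1 (n + 1)).comap_le hX.1 (fun l hl => ?_)
      fun _ _ => EventuallyEq.rfl) k
  obtain rfl : l = n + 1 := by
    simp only [mem_insert_iff, Set.mem_sdiff, mem_Icc, mem_singleton_iff] at hl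
    omega
  exact comap_measurable _

lemma conditionallyIncreasing (hX : IsMarkovProcess P X) {n : ℕ}
    (h : StochasticallyIncreasing P (X (n + 1)) (X n)) :
    ConditionallyIncreasing (processLaw P X) n (n + 1) (Iic (n + 1)) := by
  obtain ⟨S, hS, hmono⟩ := h
  rw [← map_eval_processLaw hX.1] at hS
  exact ⟨_, S, inferInstance, hX.disintegrates n,
    ae_of_ae_map (measurable_pi_apply n).aemeasurable hS, hmono⟩

lemma conditionallyIncreasing_backward (hX : IsMarkovProcess P X) {n : ℕ}
    (h : StochasticallyIncreasing P (X n) (X (n + 1))) (k : ℕ) :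
    ConditionallyIncreasing (processLaw P X) (n + 1) n (Icc n k) := by
  obtain ⟨S, hS, hmono⟩ := h
  rw [← map_eval_processLaw hX.1] at hS
  exact ⟨_, S, inferInstance, hX.disintegrates_backward n k,
    ae_of_ae_map (measurable_pi_apply (n + 1)).aemeasurable hS, hmono⟩

end IsMarkovProcess

lemma ProcessSupermodularLE.of_one {b : (d : ℕ) → (Fin d → ℝ) → ℝ} (hb : ∀ d, IsWeight (b d))
    (hX : ∀ i, Measurable (X i)) (hY : ∀ i, Measurable (Y i)) (hbX : MarginallyIntegrable b P X)
    (h : ProcessSupermodularLE 1 (processLaw P X) (processLaw Q Y)) :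
    ProcessSupermodularLE b (processLaw P X) (processLaw Q Y) := by
  intro m n
  obtain ⟨c, β, hβ, hbβ⟩ := hbX m n
  have hn := measurable_reindex n
  have := isProbabilityMeasure_processLaw (P := P) hX
  have := isProbabilityMeasure_processLaw (P := Q) hY
  have := Measure.isProbabilityMeasure_map (μ := processLaw P X) hn.aemeasurable
  have := Measure.isProbabilityMeasure_map (μ := processLaw Q Y) hn.aemeasurable
  refine (h m n).of_one (hb m) (fun k => ?_) hbβ
  rw [Measure.map_map (measurable_pi_apply k) hn]
  exact (map_eval_processLaw hX (n k)).symm ▸ hβ k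

section Comparison

variable {b : (d : ℕ) → (Fin d → ℝ) → ℝ} (hb : ∀ d, IsWeight (b d)) (hX : IsMarkovProcess P X)
  (hY : IsMarkovProcess Q Y) (hXup : ∀ i, StochasticallyIncreasing P (X (i + 1)) (X i))
  (hYup : ∀ i, StochasticallyIncreasing Q (Y i) (Y (i + 1)))
include hb hX hY hXup hYup

theorem IsMarkovProcess.processSupermodularLE_of_consecutive_le
    (hbX : MarginallyIntegrable b P X)
    (h : ∀ i, SupermodularLE 1 (consecutiveLaw P X i) (consecutiveLaw Q Y i)) :
    ProcessSupermodularLE b (processLaw P X) (processLaw Q Y) := by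
  have := isProbabilityMeasure_processLaw (P := P) hX.1
  have := isProbabilityMeasure_processLaw (P := Q) hY.1
  refine .of_one hb hX.1 hY.1 hbX (processSupermodularLE_one_of_consecutive_le
    (fun n => hX.conditionallyIncreasing (hXup n))
    (fun n => hY.conditionallyIncreasing_backward (hYup n)) fun i => ?_)
  rw [map_consecutive_processLaw hX.1, map_consecutive_processLaw hY.1]
  exact h i

theorem IsMarkovProcess.processSupermodularLE_of_consecutive_ge
    (hbY : MarginallyIntegrable b Q Y)
    (h : ∀ i, SupermodularLE 1 (consecutiveLaw Q Y i) (consecutiveLaw P X i)) :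
    ProcessSupermodularLE b (processLaw Q Y) (processLaw P X) := by
  have := isProbabilityMeasure_processLaw (P := P) hX.1
  have := isProbabilityMeasure_processLaw (P := Q) hY.1
  refine .of_one hb hY.1 hX.1 hbY (processSupermodularLE_one_of_consecutive_ge
    (fun n => hX.conditionallyIncreasing (hXup n))
    (fun n => hY.conditionallyIncreasing_backward (hYup n)) fun i => ?_)
  rw [map_consecutive_processLaw hX.1, map_consecutive_processLaw hY.1]
  exact h i

end Comparison

end Markov

section Independent

lemma integral_integral_le_integral_diagonal {p : Measure ℝ} [IsProbabilityMeasure p]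
    {G : ℝ × ℝ → ℝ} (hG : Measurable G) {C : ℝ} (hC : ∀ z, |G z| ≤ C) {S : Set ℝ}
    (hS : ∀ᵐ u ∂p, u ∈ S)
    (h : ∀ u ∈ S, ∀ v ∈ S, G (u, v) + G (v, u) ≤ G (u, u) + G (v, v)) :
    ∫ u, ∫ v, G (u, v) ∂p ∂p ≤ ∫ u, G (u, u) ∂p := by
  have hint {T : ℝ × ℝ → ℝ × ℝ} (hT : Measurable T) : Integrable (fun z => G (T z)) (p.prod p) :=
    .of_bound (hG.comp hT).aestronglyMeasurable C (ae_of_all _ fun z => hC _)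
  have hid := hint measurable_id
  have hswap := hint measurable_swap
  have hfst := hint (measurable_fst.prodMk measurable_fst)
  have hsnd := hint (measurable_snd.prodMk measurable_snd)
  have hsymm : ∫ z, (G (id z) + G z.swap) ∂p.prod p ≤
      ∫ z, (G (z.1, z.1) + G (z.2, z.2)) ∂p.prod p := by
    refine integral_mono_ae (hid.add hswap) (hfst.add hsnd) ?_
    filter_upwards [Measure.quasiMeasurePreserving_fst.ae hS,
      Measure.quasiMeasurePreserving_snd.ae hS] with z hz₁ hz₂
    exact h z.1 hz₁ z.2 hz₂
  rw [integral_add hid hswap, integral_add hfst hsnd, integral_prod_swap (fun z => G z),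
    integral_fun_fst (fun u => G (u, u)), integral_fun_snd (fun u => G (u, u))] at hsymm
  simp only [id, probReal_univ, one_smul] at hsymm
  rw [integral_prod G hid] at hsymm
  linarith

lemma IsSupermodular.monotone_sub_right {G : ℝ × ℝ → ℝ} (hG : IsSupermodular G) {u v : ℝ}
    (huv : u ≤ v) : Monotone fun z => G (v, z) - G (u, z) := by
  intro s t hst
  have h := hG (v, s) (u, t)
  rw [Prod.mk_inf_mk, Prod.mk_sup_mk, inf_eq_right.2 huv, sup_eq_left.2 huv, inf_eq_left.2 hst,
    sup_eq_right.2 hst] at h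
  change G _ - G _ ≤ G _ - G _
  linarith

lemma StochasticallyMonotoneOn.integral_add_integral_le {κ : ℝ → Measure ℝ} {S : Set ℝ}
    (hκ : StochasticallyMonotoneOn κ S) {G : ℝ × ℝ → ℝ} (hG : IsSupermodular G)
    (hint : ∀ u v, Integrable (fun z => G (u, z)) (κ v)) {u v : ℝ} (hu : u ∈ S) (hv : v ∈ S) :
    ∫ z, G (u, z) ∂κ v + ∫ z, G (v, z) ∂κ u ≤ ∫ z, G (u, z) ∂κ u + ∫ z, G (v, z) ∂κ v := by
  wlog huv : u ≤ v generalizing u v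
  · linarith [this hv hu (le_of_not_ge huv)]
  have h := hκ u hu v hv huv _ (hG.monotone_sub_right huv) ((hint _ _).sub (hint _ _))
    ((hint _ _).sub (hint _ _))
  rw [integral_sub (hint _ _) (hint _ _), integral_sub (hint _ _) (hint _ _)] at h
  linarith

lemma integral_prod_snd_le_integral_compProd {p : Measure ℝ} [IsProbabilityMeasure p]
    {κ : Kernel ℝ ℝ} [IsMarkovKernel κ] {S : Set ℝ} (hS : ∀ᵐ u ∂p, u ∈ S)
    (hκ : StochasticallyMonotoneOn κ S) {G : ℝ × ℝ → ℝ} (hGm : Measurable G)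
    (hG : IsSupermodular G) {C : ℝ} (hC : ∀ z, |G z| ≤ C) :
    ∫ z, G z ∂p.prod (p ⊗ₘ κ).snd ≤ ∫ z, G z ∂(p ⊗ₘ κ) := by
  have hbdd {α : Type} [MeasurableSpace α] {ρ : Measure α} [IsFiniteMeasure ρ] {T : α → ℝ × ℝ}
      (hT : Measurable T) : Integrable (fun a => G (T a)) ρ :=
    .of_bound (hGm.comp hT).aestronglyMeasurable C (ae_of_all _ fun _ => hC _)
  let K (q : ℝ × ℝ) : ℝ := ∫ z, G (q.1, z) ∂κ q.2
  have hK : Measurable K := by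
    have hG' : StronglyMeasurable fun q : (ℝ × ℝ) × ℝ => G (q.1.1, q.2) :=
      (hGm.comp (by fun_prop)).stronglyMeasurable
    exact (hG'.integral_kernel_prod_right' (κ := κ.comap Prod.snd measurable_snd)).measurable
  have hKC (q : ℝ × ℝ) : |K q| ≤ C := by
    simpa using norm_integral_le_of_norm_le_const (μ := κ q.2)
      (f := fun z => G (q.1, z)) (ae_of_all _ fun z => hC _)
  have hK_le : ∀ u ∈ S, ∀ v ∈ S, K (u, v) + K (v, u) ≤ K (u, u) + K (v, v) :=
    fun u hu v hv => hκ.integral_add_integral_le hG (fun _ _ => hbdd measurable_prodMk_left) hu hv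
  calc ∫ z, G z ∂p.prod (p ⊗ₘ κ).snd = ∫ u, ∫ z, G (u, z) ∂(p ⊗ₘ κ).snd ∂p :=
        integral_prod G (hbdd measurable_id)
    _ = ∫ u, ∫ v, K (u, v) ∂p ∂p := by
        refine integral_congr_ae (ae_of_all _ fun u => ?_)
        have hGu : Measurable fun z => G (u, z) := hGm.comp measurable_prodMk_left
        refine (integral_map measurable_snd.aemeasurable hGu.aestronglyMeasurable).trans ?_
        exact Measure.integral_compProd (hbdd (measurable_const.prodMk measurable_snd))
    _ ≤ ∫ u, K (u, u) ∂p := integral_integral_le_integral_diagonal hK hKC hS hK_le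
    _ = ∫ z, G z ∂(p ⊗ₘ κ) := (Measure.integral_compProd (hbdd measurable_id)).symm

variable {Ω : Type*} {mΩ : MeasurableSpace Ω} {P : Measure Ω} [IsProbabilityMeasure P]
  {X : ℕ → Ω → ℝ}

lemma StochasticallyIncreasing.integral_prod_le {U V : Ω → ℝ}
    (h : StochasticallyIncreasing P V U) (hU : Measurable U) (hV : Measurable V) {G : ℝ × ℝ → ℝ}
    (hGm : Measurable G) (hG : IsSupermodular G) {C : ℝ} (hC : ∀ z, |G z| ≤ C) :
    ∫ z, G z ∂(P.map U).prod (P.map V) ≤ ∫ ω, G (U ω, V ω) ∂P := by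
  obtain ⟨S, hS, hmono⟩ := h
  have := Measure.isProbabilityMeasure_map (μ := P) hU.aemeasurable
  have hle := integral_prod_snd_le_integral_compProd hS hmono hGm hG hC
  rwa [compProd_map_condDistrib hV.aemeasurable, Measure.snd_map_prodMk hU,
    integral_map (hU.prodMk hV).aemeasurable hGm.aestronglyMeasurable] at hle

lemma stochasticallyIncreasing_of_indepFun {U V : Ω → ℝ} (hU : Measurable U) (hV : Measurable V)
    (h : U ⟂ᵢ[P] V) : StochasticallyIncreasing P V U := by
  have := Measure.isProbabilityMeasure_map (μ := P) hU.aemeasurable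
  have := Measure.isProbabilityMeasure_map (μ := P) hV.aemeasurable
  refine ⟨{u | condDistrib V U P u = P.map V}, ?_, fun u hu v hv _ => ?_⟩
  · refine condDistrib_ae_eq_of_measure_eq_compProd (κ := Kernel.const ℝ (P.map V)) U
      hV.aemeasurable ?_
    rw [h.map_prod_eq_prod_map_map hU.aemeasurable hV.aemeasurable, Measure.compProd_const]
  · rw [hu, hv]
    exact fun _ _ _ _ => le_rfl

lemma isMarkovProcess_of_iIndepFun (hX : ∀ i, Measurable (X i)) (h : iIndepFun X P) :
    IsMarkovProcess P X := by
  refine ⟨hX, fun n B hB => ?_⟩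
  have hpast : Indep (MeasurableSpace.comap (X (n + 1)) inferInstance)
      (⨆ j ≤ n, MeasurableSpace.comap (X j) inferInstance) P := by
    have hdisj : Disjoint ({n + 1} : Set ℕ) (Iic n) := by simp
    simpa only [mem_singleton_iff, iSup_iSup_eq_left, mem_Iic] using
      indep_iSup_of_disjoint (fun i => (hX i).comap_le) h.iIndep hdisj
  have hpresent : Indep (MeasurableSpace.comap (X (n + 1)) inferInstance)
      (MeasurableSpace.comap (X n) inferInstance) P := h.indepFun (by omega)
  have hind : StronglyMeasurable[MeasurableSpace.comap (X (n + 1)) inferInstance]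
      ((X (n + 1) ⁻¹' B).indicator fun _ => (1 : ℝ)) :=
    (@stronglyMeasurable_const _ _ (_) _ _).indicator ⟨B, hB, rfl⟩
  exact (condExp_indep_eq (hX (n + 1)).comap_le (iSup₂_le fun j _ => (hX j).comap_le) hind
    hpast).trans (condExp_indep_eq (hX (n + 1)).comap_le (hX n).comap_le hind hpresent).symm

lemma IsSupermodular.comp_vecCons {f : (Fin 2 → ℝ) → ℝ} (hf : IsSupermodular f) :
    IsSupermodular fun z : ℝ × ℝ => f ![z.1, z.2] := by
  intro y z
  have hinf : ![y.1, y.2] ⊓ ![z.1, z.2] = ![(y ⊓ z).1, (y ⊓ z).2] :=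
    funext (Fin.forall_fin_two.2 ⟨rfl, rfl⟩)
  have hsup : ![y.1, y.2] ⊔ ![z.1, z.2] = ![(y ⊔ z).1, (y ⊔ z).2] :=
    funext (Fin.forall_fin_two.2 ⟨rfl, rfl⟩)
  simpa only [hinf, hsup] using hf ![y.1, y.2] ![z.1, z.2]

lemma IsSupermodular.comp_swap {G : ℝ × ℝ → ℝ} (hG : IsSupermodular G) :
    IsSupermodular fun z : ℝ × ℝ => G z.swap :=
  fun y z => hG y.swap z.swap

lemma integral_independentLaw_pair_le (hX : ∀ i, Measurable (X i)) {i j : ℕ} (hij : i ≠ j)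
    (h : StochasticallyIncreasing P (X j) (X i)) {G : ℝ × ℝ → ℝ} (hGm : Measurable G)
    (hG : IsSupermodular G) {C : ℝ} (hC : ∀ z, |G z| ≤ C) :
    ∫ x, G (x i, x j) ∂independentLaw P X ≤ ∫ ω, G (X i ω, X j ω) ∂P := by
  have (i : ℕ) : IsProbabilityMeasure (P.map (X i)) :=
    Measure.isProbabilityMeasure_map (hX i).aemeasurable
  have hij' : Measurable fun x : ℕ → ℝ => (x i, x j) := by fun_prop
  rw [← integral_map (φ := fun x : ℕ → ℝ => (x i, x j)) hij'.aemeasurable hGm.aestronglyMeasurable,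
    independentLaw, Measure.infinitePi_map_eval_prod hij]
  exact h.integral_prod_le (hX i) (hX j) hGm hG hC

lemma map_eval_independentLaw (hX : ∀ i, Measurable (X i)) (i : ℕ) :
    (independentLaw P X).map (fun x => x i) = P.map (X i) := by
  have (i : ℕ) : IsProbabilityMeasure (P.map (X i)) :=
    Measure.isProbabilityMeasure_map (hX i).aemeasurable
  exact Measure.infinitePi_map_eval _ i

lemma isProbabilityMeasure_independentLaw (hX : ∀ i, Measurable (X i)) :
    IsProbabilityMeasure (independentLaw P X) := by
  have (i : ℕ) : IsProbabilityMeasure (P.map (X i)) :=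
    Measure.isProbabilityMeasure_map (hX i).aemeasurable
  exact inferInstanceAs (IsProbabilityMeasure (Measure.infinitePi _))

lemma iIndepFun_eval_independentLaw (hX : ∀ i, Measurable (X i)) :
    iIndepFun (fun i (x : ℕ → ℝ) => x i) (independentLaw P X) := by
  have (i : ℕ) : IsProbabilityMeasure (P.map (X i)) :=
    Measure.isProbabilityMeasure_map (hX i).aemeasurable
  exact iIndepFun_infinitePi (X := fun _ x => x) fun _ => measurable_id

lemma processLaw_eval (μ : Measure (ℕ → ℝ)) : processLaw μ (fun i x => x i) = μ :=
  Measure.map_id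

lemma MarginallyIntegrable.independentLaw {b : (d : ℕ) → (Fin d → ℝ) → ℝ}
    (hbX : MarginallyIntegrable b P X) (hX : ∀ i, Measurable (X i)) :
    MarginallyIntegrable b (independentLaw P X) fun i x => x i := by
  simpa only [MarginallyIntegrable, map_eval_independentLaw hX] using hbX

lemma supermodularLE_consecutiveLaw_independentLaw (hX : ∀ i, Measurable (X i)) {i : ℕ}
    (h : StochasticallyIncreasing P (X (i + 1)) (X i) ∨
      StochasticallyIncreasing P (X i) (X (i + 1))) :
    SupermodularLE 1 (consecutiveLaw (independentLaw P X) (fun i x => x i) i)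
      (consecutiveLaw P X i) := by
  have := isProbabilityMeasure_independentLaw (P := P) hX
  have hev := measurable_consecutive i
  have hXi : Measurable fun ω => ![X i ω, X (i + 1) ω] := hev.comp (measurable_pi_iff.2 hX)
  have := isProbabilityMeasure_consecutiveLaw (P := independentLaw P X) measurable_pi_apply i
  have := isProbabilityMeasure_consecutiveLaw (P := P) hX i
  refine supermodularLE_one_iff.2 fun f hfm hf ⟨C, hC⟩ => ?_
  have hG : Measurable fun z : ℝ × ℝ => f ![z.1, z.2] := hfm.comp (by fun_prop)
  rw [consecutiveLaw, consecutiveLaw, integral_map hev.aemeasurable hfm.aestronglyMeasurable,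
    integral_map hXi.aemeasurable hfm.aestronglyMeasurable]
  rcases h with h | h
  · exact integral_independentLaw_pair_le hX (by omega) h hG hf.comp_vecCons fun _ => hC _
  · exact integral_independentLaw_pair_le hX (by omega) h (hG.comp measurable_swap)
      hf.comp_vecCons.comp_swap fun _ => hC _

namespace IsMarkovProcess

variable {b : (d : ℕ) → (Fin d → ℝ) → ℝ}

theorem isPSMD_of_stochasticallyIncreasing (hX : IsMarkovProcess P X) (hb : ∀ d, IsWeight (b d))
    (hbX : MarginallyIntegrable b P X)
    (hXup : ∀ i, StochasticallyIncreasing P (X (i + 1)) (X i)) : IsPSMD b P X := by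
  have := isProbabilityMeasure_independentLaw (P := P) hX.1
  have hind := iIndepFun_eval_independentLaw (P := P) hX.1
  rw [IsPSMD, ← processLaw_eval (independentLaw P X)]
  exact hX.processSupermodularLE_of_consecutive_ge hb
    (isMarkovProcess_of_iIndepFun measurable_pi_apply hind) hXup
    (fun i => stochasticallyIncreasing_of_indepFun (measurable_pi_apply _) (measurable_pi_apply _)
      (hind.indepFun (by omega))) (hbX.independentLaw hX.1)
    fun i => supermodularLE_consecutiveLaw_independentLaw hX.1 (.inl (hXup i))

theorem isPSMD_of_stochasticallyIncreasing_backward (hX : IsMarkovProcess P X)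
    (hb : ∀ d, IsWeight (b d)) (hbX : MarginallyIntegrable b P X)
    (hXup : ∀ i, StochasticallyIncreasing P (X i) (X (i + 1))) : IsPSMD b P X := by
  have := isProbabilityMeasure_independentLaw (P := P) hX.1
  have hind := iIndepFun_eval_independentLaw (P := P) hX.1
  rw [IsPSMD, ← processLaw_eval (independentLaw P X)]
  exact (isMarkovProcess_of_iIndepFun measurable_pi_apply hind
    ).processSupermodularLE_of_consecutive_le hb hX
    (fun i => stochasticallyIncreasing_of_indepFun (measurable_pi_apply _) (measurable_pi_apply _)
      (hind.indepFun (by omega))) hXup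
    (hbX.independentLaw hX.1)
    fun i => supermodularLE_consecutiveLaw_independentLaw hX.1 (.inr (hXup i))

end IsMarkovProcess

end Independent

theorem proposition1p1 {Ω Ω' : Type*} [MeasurableSpace Ω] [MeasurableSpace Ω']
    (P : Measure Ω) [IsProbabilityMeasure P] (Q : Measure Ω') [IsProbabilityMeasure Q]
    (X : ℕ → Ω → ℝ) (Y : ℕ → Ω' → ℝ)
    (b : (d : ℕ) → (Fin d → ℝ) → ℝ) (hb : ∀ d, IsWeight (b d))
    (hbX : MarginallyIntegrable b P X) (hbY : MarginallyIntegrable b Q Y)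
    (hX : IsMarkovProcess P X) (hY : IsMarkovProcess Q Y)
    (hXup : ∀ i, StochasticallyIncreasing P (X (i + 1)) (X i))
    (hYup : ∀ i, StochasticallyIncreasing Q (Y i) (Y (i + 1))) :
    ((∀ i, SupermodularLE (b 2) (consecutiveLaw P X i) (consecutiveLaw Q Y i)) →
      ProcessSupermodularLE b (processLaw P X) (processLaw Q Y) ∧
        IsPSMD b P X ∧ IsPSMD b Q Y) ∧
    ((∀ i, SupermodularLE (b 2) (consecutiveLaw Q Y i) (consecutiveLaw P X i)) →
      ProcessSupermodularLE b (processLaw Q Y) (processLaw P X) ∧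
        IsPSMD b P X ∧ IsPSMD b Q Y) := by
  have hX2 (i : ℕ) : IsProbabilityMeasure (consecutiveLaw P X i) :=
    isProbabilityMeasure_consecutiveLaw hX.1 i
  have hY2 (i : ℕ) : IsProbabilityMeasure (consecutiveLaw Q Y i) :=
    isProbabilityMeasure_consecutiveLaw hY.1 i
  have hXpsmd := hX.isPSMD_of_stochasticallyIncreasing hb hbX hXup
  have hYpsmd := hY.isPSMD_of_stochasticallyIncreasing_backward hb hbY hYup
  refine ⟨fun h => ⟨?_, hXpsmd, hYpsmd⟩, fun h => ⟨?_, hXpsmd, hYpsmd⟩⟩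
  · exact hX.processSupermodularLE_of_consecutive_le hb hY hXup hYup hbX
      fun i => (h i).to_one (hb 2)
  · exact hX.processSupermodularLE_of_consecutive_ge hb hY hXup hYup hbY
      fun i => (h i).to_one (hb 2)
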